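/- All groupoids are topological groupoids that are étale and locally compact with Hausdorff object space (the arrow space may be non-Hausdorff). Products \(g\cdot h\) in a groupoid or an action are defined when \(s(g)=r(h)\), where \(r\) denotes the anchor map of a left action and \(s\) that of a right action. A bisection of a groupoid \(H\) is an open subset of \(H\) on which \(r\) and \(s\) are injective; \(\mathcal B(H)\) is the set of bisections, with \(UV=\{uv : u\in U,\ v\in V,\ s(u)=r(v)\}\) and \(U^*=\{u^{-1}:u\in U\}\); \(s(U)\) and \(r(U)\) are the domain and the codomain of \(U\). A groupoid correspondence \(X\colon G\leftarrow G\) is a topological space with commuting left and right actions of \(G\), such that the right action is free and proper and the right anchor map \(s\colon X\to G^0\) is a local homeomorphism. Let \(R\subseteq G^0\) be open and \(G\)-invariant; \(X\) is regular on \(R\) if the map \(r^{-1}(R)/G\to R\) induced by \(r\colon X\to G^0\) is proper and surjective. A \((G,X,R)\)-action on a topological space \(Y\) is a \(G\)-action on \(Y\) with a continuous open map \(X\times_{s,G^0,r}Y\to Y\), \((x,y)\mapsto x\cdot y\), such that (a) \(r(x\cdot y)=r(x)\) and \(g\cdot(x\cdot y)=(g\cdot x)\cdot y\); (b) \(x\cdot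 y=x'\cdot y'\) if and only if there is \(g\in G\) with \(x'=x\cdot g\) and \(y=g\cdot y'\); (c) \(r^{-1}(R)\subseteq X\cdot Y\); (d) for every compact \(K\subseteq X/G\), the set of all \(x\cdot y\) with \([x]\in K\) is closed in \(Y\). A map \(\varphi\colon Y_1\to Y_2\) between two such actions is \((G,X)\)-equivariant if it is compatible with the anchor maps and the multiplications by \(G\) and \(X\), and \(\varphi^{-1}(X\cdot Y_2)=X\cdot Y_1\). A groupoid model of \((G,X,R)\) is a groupoid \(M\) with bijections between \((G,X,R)\)-actions on \(Y\) and \(M\)-actions on \(Y\) for all topological spaces \(Y\), such that a continuous map is \((G,X)\)-equivariant if and only if it is \(M\)-equivariant for the associated actions. An actor \(M\to H\) is an action of \(M\) on the arrow space of \(H\) that commutes with the right translation action of \(H\); it is proper if the map \(H^0\cong H/H\to M^0\) induced by its anchor map is proper. **Statement.** Let \(G\) and \(H\) be groupoids, let \(R\subseteq G^0\) be open and \(G\)-invariant, and let \(X\colon G\leftarrow G\) be a groupoid correspondence that is regular on \(R\). Assume that \(G\) is discrete. Let \(M\) be a groupoid model of \((G,X,R)\). There is a bijection between actors \(M\to H\)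 and maps \(\theta\colon G\sqcup X\to\mathcal B(H)\) such that 1. for \(x,y\in G\sqcup X\) with \(x\in G\) or \(y\in G\): \(\theta_x\theta_y=\theta_{xy}\) if \(s(x)=r(y)\), and \(\theta_x\theta_y=\emptyset\) if \(s(x)\neq r(y)\); 2. \(\theta_x^*\theta_x=\theta_{s(x)}\) for all \(x\in X\), and \(\theta_x^*\theta_y=\emptyset\) for \(x,y\in X\) in different right \(G\)-orbits; 3. the domains of \(\theta_v\) for \(v\in G^0\) cover \(H^0\); 4. if \(v\in R\), then the domain of \(\theta_v\) is contained in the union of the codomains of \(\theta_y\) for \(y\in X\); 5. the codomain of \(\theta_x\) is closed in \(H^0\) for all \(x\in X\). (Objects \(v\in G^0\) are identified with their unit arrows.) The bijection sends an actor to the unique \(\theta\) for which, in the \((G,X,R)\)-action on the arrow space of \(H\) that corresponds to the actor, each \(z\in G\sqcup X\) acts by left multiplication with the bisection \(\theta_z\); that is, \(z\cdot h\) is defined if and only if there is \(t\in\theta_z\) with \(s(t)=r(h)\), and then \(z\cdot h=t h\) for the unique such \(t\). The actor is proper if and only if \(\theta_v\) is a compact subset of \(H^0\) for all \(v\in G^0\).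 In that case, condition 5 is redundant: if \(\theta\) satisfies 1–4 and all \(\theta_v\) with \(v\in G^0\) are compact subsets of \(H^0\), then 5 holds. -/

import Mathlib

universe u

/-- An étale, locally compact topological groupoid with Hausdorff object space; the arrow
space need not be Hausdorff.  The product `g · h` is defined when `s g = r h`. -/
structure EtaleGroupoid : Type (u + 1) where
  /-- the object space -/
  Obj : Type u
  /-- the arrow space -/
  Arr : Type u
  [topObj : TopologicalSpace Obj]
  [topArr : TopologicalSpace Arr]
  [t2Obj : T2Space Obj]
  [locallyCompactObj : LocallyCompactSpace Obj]
  /-- range -/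
  r : Arr → Obj
  /-- source -/
  s : Arr → Obj
  /-- unit arrows -/
  one : Obj → Arr
  /-- inversion -/
  inv : Arr → Arr
  /-- multiplication of composable arrows -/
  mul : (g h : Arr) → s g = r h → Arr
  r_one : ∀ v, r (one v) = v
  s_one : ∀ v, s (one v) = v
  r_mul : ∀ g h e, r (mul g h e) = r g
  s_mul : ∀ g h e, s (mul g h e) = s h
  r_inv : ∀ g, r (inv g) = s g
  s_inv : ∀ g, s (inv g) = r g
  one_mul : ∀ g, mul (one (r g)) g (s_one (r g)) = g
  mul_one : ∀ g, mul g (one (s g)) (r_one (s g)).symm = g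
  mul_assoc : ∀ g h k (e : s g = r h) (e' : s h = r k),
    mul (mul g h e) k ((s_mul g h e).trans e') = mul g (mul h k e') (e.trans (r_mul h k e').symm)
  inv_mul : ∀ g, mul (inv g) g (s_inv g) = one (s g)
  mul_inv : ∀ g, mul g (inv g) (r_inv g).symm = one (r g)
  continuous_one : Continuous one
  continuous_inv : Continuous inv
  continuous_mul : Continuous fun p : {p : Arr × Arr // s p.1 = r p.2} => mul p.1.1 p.1.2 p.2
  isLocalHomeomorph_r : IsLocalHomeomorph r
  isLocalHomeomorph_s : IsLocalHomeomorph s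

attribute [instance] EtaleGroupoid.topObj EtaleGroupoid.topArr EtaleGroupoid.t2Obj
  EtaleGroupoid.locallyCompactObj

namespace EtaleGroupoid

/-- A set of objects is invariant if it contains both or none of the end points of any arrow. -/
def IsInvariant (G : EtaleGroupoid.{u}) (R : Set G.Obj) : Prop :=
  ∀ g : G.Arr, G.s g ∈ R ↔ G.r g ∈ R

/-- A bisection (slice): an open set of arrows on which `r` and `s` are injective. -/
def IsBisection (H : EtaleGroupoid.{u}) (S : Set H.Arr) : Prop :=
  IsOpen S ∧ Set.InjOn H.r S ∧ Set.InjOn H.s S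

/-- The type of bisections of a groupoid. -/
def Bisection (H : EtaleGroupoid.{u}) : Type u := {S : Set H.Arr // H.IsBisection S}

/-- The elementwise product of two sets of arrows. -/
def setMul (H : EtaleGroupoid.{u}) (S T : Set H.Arr) : Set H.Arr :=
  {k | ∃ a ∈ S, ∃ b ∈ T, ∃ e : H.s a = H.r b, k = H.mul a b e}

/-- The adjoint `S* = {a⁻¹ | a ∈ S}` of a set of arrows. -/
def setStar (H : EtaleGroupoid.{u}) (S : Set H.Arr) : Set H.Arr := H.inv '' S

end EtaleGroupoid

/-- A continuous left action of `G` on `Y`; `g · y` is defined when `s g = anchor y`. -/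
@[ext]
structure LeftAction (G : EtaleGroupoid.{u}) (Y : Type u) [TopologicalSpace Y] : Type u where
  anchor : Y → G.Obj
  act : (g : G.Arr) → (y : Y) → G.s g = anchor y → Y
  continuous_anchor : Continuous anchor
  continuous_act :
    Continuous fun p : {p : G.Arr × Y // G.s p.1 = anchor p.2} => act p.1.1 p.1.2 p.2
  anchor_act : ∀ g y e, anchor (act g y e) = G.r g
  one_act : ∀ y, act (G.one (anchor y)) y (G.s_one (anchor y)) = y
  mul_act : ∀ g h y (e : G.s g = G.r h) (e' : G.s h = anchor y),
    act (G.mul g h e) y ((G.s_mul g h e).trans e') =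
      act g (act h y e') (e.trans (anchor_act h y e').symm)

/-- A continuous right action of `G` on `Y`; `y · g` is defined when `anchor y = r g`. -/
@[ext]
structure RightAction (G : EtaleGroupoid.{u}) (Y : Type u) [TopologicalSpace Y] : Type u where
  anchor : Y → G.Obj
  act : (y : Y) → (g : G.Arr) → anchor y = G.r g → Y
  continuous_anchor : Continuous anchor
  continuous_act :
    Continuous fun p : {p : Y × G.Arr // anchor p.1 = G.r p.2} => act p.1.1 p.1.2 p.2
  anchor_act : ∀ y g e, anchor (act y g e) = G.s g
  act_one : ∀ y, act y (G.one (anchor y)) (G.r_one (anchor y)).symm = y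
  act_mul : ∀ y g h (e : anchor y = G.r g) (e' : G.s g = G.r h),
    act y (G.mul g h e') (e.trans (G.r_mul g h e').symm) =
      act (act y g e) h ((anchor_act y g e).trans e')

/-- Equivariance of a map between two left `G`-spaces (it includes compatibility with the anchor
maps, without which the right hand side `g · φ y` is not defined). -/
def LeftAction.IsEquivariant {G : EtaleGroupoid.{u}} {Y₁ Y₂ : Type u} [TopologicalSpace Y₁]
    [TopologicalSpace Y₂] (a₁ : LeftAction G Y₁) (a₂ : LeftAction G Y₂) (φ : Y₁ → Y₂) : Prop :=
  ∃ hφ : ∀ y, a₂.anchor (φ y) = a₁.anchor y,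
    ∀ (g : G.Arr) (y : Y₁) (e : G.s g = a₁.anchor y),
      φ (a₁.act g y e) = a₂.act g (φ y) (e.trans (hφ y).symm)

/-- A groupoid correspondence `X : G ← H`: commuting actions of `G` on the left and of `H` on the
right, such that the right action is free and proper and the right anchor map is étale. -/
structure GroupoidCorrespondence (G H : EtaleGroupoid.{u}) : Type (u + 1) where
  carrier : Type u
  [top : TopologicalSpace carrier]
  /-- the left action of `G`, with anchor map `r` -/
  left : LeftAction G carrier
  /-- the right action of `H`, with anchor map `s` -/
  right : RightAction H carrier
  right_anchor_left_act : ∀ g x e, right.anchor (left.act g x e) = right.anchor x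
  left_anchor_right_act : ∀ x h e, left.anchor (right.act x h e) = left.anchor x
  act_comm : ∀ g x h (e : G.s g = left.anchor x) (e' : right.anchor x = H.r h),
    right.act (left.act g x e) h ((right_anchor_left_act g x e).trans e') =
      left.act g (right.act x h e') (e.trans (left_anchor_right_act x h e').symm)
  right_free : ∀ x h e, right.act x h e = x → h = H.one (right.anchor x)
  right_proper : IsProperMap
    fun p : {p : carrier × H.Arr // right.anchor p.1 = H.r p.2} =>
      ((right.act p.1.1 p.1.2 p.2, p.1.1) : carrier × carrier)
  isLocalHomeomorph_right_anchor : IsLocalHomeomorph right.anchor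

attribute [instance] GroupoidCorrespondence.top

namespace GroupoidCorrespondence

variable {G H : EtaleGroupoid.{u}}

/-- The left anchor map `r : X → G⁰`. -/
def r (X : GroupoidCorrespondence G H) (x : X.carrier) : G.Obj := X.left.anchor x

/-- The right anchor map `s : X → H⁰`. -/
def s (X : GroupoidCorrespondence G H) (x : X.carrier) : H.Obj := X.right.anchor x

/-- The product `g · x`. -/
def lmul (X : GroupoidCorrespondence G H) (g : G.Arr) (x : X.carrier) (e : G.s g = X.r x) :
    X.carrier := X.left.act g x e

/-- The product `x · h`. -/
def rmul (X : GroupoidCorrespondence G H) (x : X.carrier) (h : H.Arr) (e : X.s x = H.r h) :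
    X.carrier := X.right.act x h e

/-- Two elements are related if they lie in the same right `H`-orbit. -/
def SameOrbit (X : GroupoidCorrespondence G H) (x x' : X.carrier) : Prop :=
  ∃ (h : H.Arr) (e : X.s x = H.r h), x' = X.rmul x h e

/-- The orbit equivalence relation of the right `H`-action. -/
def orbitSetoid (X : GroupoidCorrespondence G H) : Setoid X.carrier where
  r := X.SameOrbit
  iseqv :=
    { refl := fun x => ⟨H.one (X.s x), (H.r_one _).symm, (X.right.act_one x).symm⟩
      symm := by
        rintro x x' ⟨h, e, rfl⟩
        refine ⟨H.inv h, (X.right.anchor_act x h e).trans (H.r_inv h).symm, ?_⟩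
        have h1 := X.right.act_mul x h (H.inv h) e (H.r_inv h).symm
        refine Eq.trans ?_ h1
        have key : ∀ (k : H.Arr) (ek : X.right.anchor x = H.r k),
            k = H.one (X.right.anchor x) → x = X.right.act x k ek := by
          rintro k ek rfl
          exact (X.right.act_one x).symm
        refine key _ _ ?_
        rw [H.mul_inv h]
        exact congrArg H.one e.symm
      trans := by
        rintro x x' x'' ⟨h, e, rfl⟩ ⟨k, e', rfl⟩
        have e2 : H.s h = H.r k := (X.right.anchor_act x h e).symm.trans e'
        exact ⟨H.mul h k e2, e.trans (H.r_mul h k e2).symm,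
          (X.right.act_mul x h k e e2).symm⟩ }

/-- The orbit space `X/H`, with the quotient topology. -/
abbrev Orbits (X : GroupoidCorrespondence G H) : Type u := Quotient X.orbitSetoid

/-- The map `r_* : X/H → G⁰` induced by the left anchor map. -/
def rStar (X : GroupoidCorrespondence G H) : X.Orbits → G.Obj :=
  Quotient.lift X.r (by
    rintro x x' ⟨h, e, rfl⟩
    exact (X.left_anchor_right_act x h e).symm)

/-- `X` is regular on `R` if the map `r⁻¹(R)/H → R` induced by `r` is proper and surjective. -/
def IsRegularOn (X : GroupoidCorrespondence G H) (R : Set G.Obj) : Prop :=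
  IsProperMap (R.restrictPreimage X.rStar) ∧ Function.Surjective (R.restrictPreimage X.rStar)

end GroupoidCorrespondence

/-- An action of `(G, X, R)` on a topological space `Y`: an action of `G` on `Y` together with a
continuous open multiplication map `X ×_{s,G⁰,r} Y → Y` with the following properties. -/
@[ext]
structure CorrAction {G : EtaleGroupoid.{u}} (X : GroupoidCorrespondence G G) (R : Set G.Obj)
    (Y : Type u) [TopologicalSpace Y] : Type u extends LeftAction G Y where
  /-- the multiplication `x · y` for `s x = r y` -/
  xact : (x : X.carrier) → (y : Y) → X.s x = anchor y → Y
  continuous_xact :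
    Continuous fun p : {p : X.carrier × Y // X.s p.1 = anchor p.2} => xact p.1.1 p.1.2 p.2
  isOpenMap_xact :
    IsOpenMap fun p : {p : X.carrier × Y // X.s p.1 = anchor p.2} => xact p.1.1 p.1.2 p.2
  anchor_xact : ∀ x y e, anchor (xact x y e) = X.r x
  act_xact : ∀ g x y (e : G.s g = X.r x) (e' : X.s x = anchor y),
    act g (xact x y e') (e.trans (anchor_xact x y e').symm) =
      xact (X.lmul g x e) y ((X.right_anchor_left_act g x e).trans e')
  xact_eq_iff : ∀ x y x' y' (e : X.s x = anchor y) (e' : X.s x' = anchor y'),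
    xact x y e = xact x' y' e' ↔
      ∃ (g : G.Arr) (e₁ : X.s x = G.r g) (e₂ : G.s g = anchor y'),
        x' = X.rmul x g e₁ ∧ y = act g y' e₂
  exists_xact_of_mem : ∀ y, anchor y ∈ R → ∃ x y' e, y = xact x y' e
  isClosed_xact : ∀ K : Set X.Orbits, IsCompact K →
    IsClosed {y : Y | ∃ x y' e, (Quotient.mk X.orbitSetoid x) ∈ K ∧ y = xact x y' e}

/-- The image `X · Y` of the multiplication map. -/
def CorrAction.image {G : EtaleGroupoid.{u}} {X : GroupoidCorrespondence G G} {R : Set G.Obj}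
    {Y : Type u} [TopologicalSpace Y] (c : CorrAction X R Y) : Set Y :=
  {y | ∃ x y' e, y = c.xact x y' e}

/-- `(G, X)`-equivariance of a map between two `(G, X, R)`-actions. -/
def CorrAction.IsEquivariant {G : EtaleGroupoid.{u}} {X : GroupoidCorrespondence G G}
    {R : Set G.Obj} {Y₁ Y₂ : Type u} [TopologicalSpace Y₁] [TopologicalSpace Y₂]
    (c₁ : CorrAction X R Y₁) (c₂ : CorrAction X R Y₂) (φ : Y₁ → Y₂) : Prop :=
  (∃ hφ : ∀ y, c₂.anchor (φ y) = c₁.anchor y,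
    (∀ (g : G.Arr) (y : Y₁) (e : G.s g = c₁.anchor y),
      φ (c₁.act g y e) = c₂.act g (φ y) (e.trans (hφ y).symm)) ∧
    (∀ (x : X.carrier) (y : Y₁) (e : X.s x = c₁.anchor y),
      φ (c₁.xact x y e) = c₂.xact x (φ y) (e.trans (hφ y).symm))) ∧
  φ ⁻¹' c₂.image = c₁.image

/-- A groupoid model of `(G, X, R)`: an étale groupoid `M` with, for all topological spaces `Y`,
a bijection between `(G, X, R)`-actions and `M`-actions on `Y`; it is natural in the sense that a
continuous map is `(G, X)`-equivariant if and only if it is `M`-equivariant. -/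
structure GroupoidModel {G : EtaleGroupoid.{u}} (X : GroupoidCorrespondence G G)
    (R : Set G.Obj) : Type (u + 1) where
  M : EtaleGroupoid.{u}
  actionEquiv : ∀ (Y : Type u) [TopologicalSpace Y], CorrAction X R Y ≃ LeftAction M Y
  natural : ∀ (Y₁ Y₂ : Type u) [TopologicalSpace Y₁] [TopologicalSpace Y₂]
    (c₁ : CorrAction X R Y₁) (c₂ : CorrAction X R Y₂) (φ : Y₁ → Y₂), Continuous φ →
    (c₁.IsEquivariant c₂ φ ↔
      (actionEquiv Y₁ c₁).IsEquivariant (actionEquiv Y₂ c₂) φ)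

/-- An actor `G → H`: an action of `G` on the arrow space of `H` that commutes with the right
translation action of `H`. -/
@[ext]
structure Actor (G H : EtaleGroupoid.{u}) : Type u extends LeftAction G H.Arr where
  anchor_mul : ∀ h k e, anchor (H.mul h k e) = anchor h
  s_act : ∀ g h e, H.s (act g h e) = H.s h
  act_mul : ∀ g h k (e : G.s g = anchor h) (e' : H.s h = H.r k),
    H.mul (act g h e) k ((s_act g h e).trans e') =
      act g (H.mul h k e') (e.trans (anchor_mul h k e').symm)

/-- The map `H/H ≅ H⁰ → G⁰` induced by the anchor map of an actor. -/
def Actor.objMap {G H : EtaleGroupoid.{u}} (a : Actor G H) (ω : H.Obj) : G.Obj :=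
  a.anchor (H.one ω)

/-- An actor is proper if the induced map `H⁰ → G⁰` is proper. -/
def Actor.IsProper {G H : EtaleGroupoid.{u}} (a : Actor G H) : Prop := IsProperMap a.objMap

section Families

variable {G : EtaleGroupoid.{u}} {X : GroupoidCorrespondence G G}

/-- The conditions on a map `θ : G ⊔ X → {bisections of H}`, without the closedness
condition.  Products of elements that are not composable are read as empty, so that the
corresponding products of bisections have to be empty. -/
structure IsPreActorFamily (R : Set G.Obj) {H : EtaleGroupoid.{u}}
    (θ : G.Arr ⊕ X.carrier → H.Bisection) : Prop where
  mul_arr_arr : ∀ (g g' : G.Arr) (e : G.s g = G.r g'),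
    H.setMul (θ (.inl g)).1 (θ (.inl g')).1 = (θ (.inl (G.mul g g' e))).1
  mul_arr_arr_empty : ∀ g g' : G.Arr, G.s g ≠ G.r g' →
    H.setMul (θ (.inl g)).1 (θ (.inl g')).1 = ∅
  mul_arr_corr : ∀ (g : G.Arr) (x : X.carrier) (e : G.s g = X.r x),
    H.setMul (θ (.inl g)).1 (θ (.inr x)).1 = (θ (.inr (X.lmul g x e))).1
  mul_arr_corr_empty : ∀ (g : G.Arr) (x : X.carrier), G.s g ≠ X.r x →
    H.setMul (θ (.inl g)).1 (θ (.inr x)).1 = ∅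
  mul_corr_arr : ∀ (x : X.carrier) (g : G.Arr) (e : X.s x = G.r g),
    H.setMul (θ (.inr x)).1 (θ (.inl g)).1 = (θ (.inr (X.rmul x g e))).1
  mul_corr_arr_empty : ∀ (x : X.carrier) (g : G.Arr), X.s x ≠ G.r g →
    H.setMul (θ (.inr x)).1 (θ (.inl g)).1 = ∅
  star_mul_self : ∀ x : X.carrier,
    H.setMul (H.setStar (θ (.inr x)).1) (θ (.inr x)).1 = (θ (.inl (G.one (X.s x)))).1
  star_mul_empty : ∀ x y : X.carrier, ¬ X.SameOrbit x y →
    H.setMul (H.setStar (θ (.inr x)).1) (θ (.inr y)).1 = ∅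
  cover : ∀ ω : H.Obj, ∃ v : G.Obj, ω ∈ H.s '' (θ (.inl (G.one v))).1
  cover_regular : ∀ v ∈ R,
    H.s '' (θ (.inl (G.one v))).1 ⊆ ⋃ y : X.carrier, H.r '' (θ (.inr y)).1

/-- The closedness condition: the codomain of `θ x` is closed for all `x ∈ X`. -/
def HasClosedCodomains {H : EtaleGroupoid.{u}} (θ : G.Arr ⊕ X.carrier → H.Bisection) : Prop :=
  ∀ x : X.carrier, IsClosed (H.r '' (θ (.inr x)).1)

/-- `θ v` is a compact subset of `H⁰` for all units `v ∈ G⁰`. -/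
def HasCompactUnits {H : EtaleGroupoid.{u}} (θ : G.Arr ⊕ X.carrier → H.Bisection) : Prop :=
  ∀ v : G.Obj, (θ (.inl (G.one v))).1 ⊆ Set.range H.one ∧ IsCompact (θ (.inl (G.one v))).1

/-- The `(G, X, R)`-action `c` on the arrow space of `H` is given by left multiplication with the
bisections `θ z`: for `z ∈ G ⊔ X`, the partial map `h ↦ z · h` equals (with the same domain) the
partial map `h ↦ θ z · h`, which sends `h` to `t · h` for the unique `t ∈ θ z` with
`s t = r h`. -/
def ActsByFamily {R : Set G.Obj} {H : EtaleGroupoid.{u}} (c : CorrAction X R H.Arr)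
    (θ : G.Arr ⊕ X.carrier → H.Bisection) : Prop :=
  (∀ (g : G.Arr) (h k : H.Arr), (∃ e : G.s g = c.anchor h, k = c.act g h e) ↔
    ∃ t ∈ (θ (.inl g)).1, ∃ e : H.s t = H.r h, k = H.mul t h e) ∧
  (∀ (x : X.carrier) (h k : H.Arr), (∃ e : X.s x = c.anchor h, k = c.xact x h e) ↔
    ∃ t ∈ (θ (.inr x)).1, ∃ e : H.s t = H.r h, k = H.mul t h e)

end Families

/-! The bijection has two halves. First, an `M`-action on the arrow space of `H` commutes with right
translations if and only if the corresponding (G,X,R)-action does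
(`GroupoidModel.commutesRight_iff`). Only the naturality of the model is available, so commutation
is phrased through equivariant maps: a map `f` to a space `Z` is invariant when `f` paired with the
anchor map is equivariant into `Z × M⁰`, where `M` acts trivially on `Z` (`invariant_iff`);
compatibility with right translation says that the multiplication of `H` is equivariant on
composable pairs, where the action is through the first factor.

Second, as `G` is discrete, so are `G⁰`, `X` and `X/G`. An action is then a family of partial maps
`h ↦ z · h`. If they commute with right translations, each is left multiplication by the set of all
`t` with `t = z · 1_{s(t)}`. These sets are bisections, and the axioms of an action become
conditions 1–5. Conversely, `IsPreActorFamily.corrAction` rebuilds the action: the units in the sets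
`θ v` partition `H⁰`, which gives the anchor map, and condition 5 gives (d) because compact subsets
of `X/G` are finite.

For properness, compose the map `H⁰ → M⁰` of the actor with the anchor map `M⁰ → G⁰` of the
universal action; the fibre of the composite over `v` is `θ v`. The main point is that `M⁰ → G⁰` has
compact fibres (`isCompact_univ_anchor_preimage`). The ultrafilters on `M⁰` that live on a single
fibre form a space with compact fibres over `G⁰`, and regularity makes it a (G,X,R)-space. Its
canonical map to `M⁰` is left inverse to the inclusion of principal ultrafilters, because
equivariant continuous maps to `M⁰` are unique; so each fibre of `M⁰` is the image of a compact
space. -/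

open Set Filter

/-! ### Cancellation in groupoids, and discreteness passing from `G` to `X`. -/

namespace EtaleGroupoid

variable (H : EtaleGroupoid.{u})

theorem mul_congr {a a' b b' : H.Arr} (ha : a = a') (hb : b = b') (e : H.s a = H.r b)
    (e' : H.s a' = H.r b') : H.mul a b e = H.mul a' b' e' := by
  subst ha hb; rfl

theorem one_mul' {v : H.Obj} {g : H.Arr} (e : H.s (H.one v) = H.r g) :
    H.mul (H.one v) g e = g := by
  obtain rfl : v = H.r g := (H.s_one v).symm.trans e
  exact H.one_mul g

theorem mul_one' {v : H.Obj} {g : H.Arr} (e : H.s g = H.r (H.one v)) :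
    H.mul g (H.one v) e = g := by
  obtain rfl : v = H.s g := (H.r_one v).symm.trans e.symm
  exact H.mul_one g

theorem inv_mul_cancel_left (a b : H.Arr) (e : H.s a = H.r b) :
    H.mul (H.inv a) (H.mul a b e) ((H.s_inv a).trans (H.r_mul a b e).symm) = b := by
  rw [← H.mul_assoc (H.inv a) a b (H.s_inv a) e]
  exact (H.mul_congr (H.inv_mul a) rfl _ ((H.s_one _).trans e)).trans (H.one_mul' _)

theorem mul_inv_cancel_left (a b : H.Arr) (e : H.r a = H.r b) :
    H.mul a (H.mul (H.inv a) b ((H.s_inv a).trans e))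
      ((H.r_inv a).symm.trans (H.r_mul _ _ _).symm) = b := by
  rw [← H.mul_assoc a (H.inv a) b (H.r_inv a).symm ((H.s_inv a).trans e)]
  exact (H.mul_congr (H.mul_inv a) rfl _ ((H.s_one _).trans e)).trans (H.one_mul' _)

theorem mul_inv_cancel_right (a b : H.Arr) (e : H.s a = H.r b) :
    H.mul (H.mul a b e) (H.inv b) ((H.s_mul a b e).trans (H.r_inv b).symm) = a := by
  rw [H.mul_assoc a b (H.inv b) e (H.r_inv b).symm]
  exact (H.mul_congr rfl (H.mul_inv b) _ (e.trans (H.r_one _).symm)).trans (H.mul_one' _)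

theorem mul_left_cancel {a b b' : H.Arr} {e : H.s a = H.r b} {e' : H.s a = H.r b'}
    (h : H.mul a b e = H.mul a b' e') : b = b' := by
  rw [← H.inv_mul_cancel_left a b e, ← H.inv_mul_cancel_left a b' e']
  exact H.mul_congr rfl h _ _

theorem eq_one_of_mul_self {a : H.Arr} {e : H.s a = H.r a} (h : H.mul a a e = a) :
    a = H.one (H.s a) :=
  H.mul_left_cancel (a := a) (e := e) (e' := (H.r_one _).symm) (h.trans (H.mul_one a).symm)

theorem one_injective : Function.Injective H.one :=
  Function.LeftInverse.injective H.r_one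

/-- A continuous map is a local homeomorphism if its composite with the source map is one. -/
theorem isLocalHomeomorph_of_s_comp {T : Type*} [TopologicalSpace T] {f : T → H.Arr}
    (hf : Continuous f) (h : IsLocalHomeomorph (H.s ∘ f)) : IsLocalHomeomorph f :=
  .of_comp h H.isLocalHomeomorph_s hf

theorem continuous_r : Continuous H.r := H.isLocalHomeomorph_r.continuous

theorem continuous_s : Continuous H.s := H.isLocalHomeomorph_s.continuous

theorem discreteTopology_obj (hH : DiscreteTopology H.Arr) : DiscreteTopology H.Obj :=
  DiscreteTopology.of_continuous_injective H.continuous_one H.one_injective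

end EtaleGroupoid

theorem GroupoidCorrespondence.discreteTopology {G H : EtaleGroupoid.{u}}
    (X : GroupoidCorrespondence G H) (hH : DiscreteTopology H.Arr) :
    DiscreteTopology X.carrier := by
  have := H.discreteTopology_obj hH
  rw [discreteTopology_iff_isOpen_singleton]
  intro x
  obtain ⟨e, hx, he⟩ := X.isLocalHomeomorph_right_anchor x
  have : ({x} : Set X.carrier) = e.source ∩ e ⁻¹' {e x} := by
    ext y
    constructor
    · rintro rfl
      exact ⟨hx, rfl⟩
    · rintro ⟨hy, hyx⟩
      exact e.injOn hy hx hyx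
  rw [this]
  exact e.isOpen_inter_preimage (isOpen_discrete _)

/-! ### Commutation with right translations, transferred through the model. -/

/-- The canonical action of a groupoid on `Z × M⁰`, trivial in the first factor. -/
def LeftAction.prodObj (M : EtaleGroupoid.{u}) (Z : Type u) [TopologicalSpace Z] :
    LeftAction M (Z × M.Obj) where
  anchor := Prod.snd
  act g p _ := (p.1, M.r g)
  continuous_anchor := continuous_snd
  continuous_act := by
    have := M.continuous_r
    fun_prop
  anchor_act _ _ _ := rfl
  one_act p := Prod.ext rfl (M.r_one _)
  mul_act _ _ _ _ _ := Prod.ext rfl (M.r_mul _ _ _)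

/-- The canonical action of a groupoid on its object space. -/
def LeftAction.obj (M : EtaleGroupoid.{u}) : LeftAction M M.Obj where
  anchor := id
  act g _ _ := M.r g
  continuous_anchor := continuous_id
  continuous_act := by
    have := M.continuous_r
    fun_prop
  anchor_act _ _ _ := rfl
  one_act v := M.r_one v
  mul_act _ _ _ _ _ := M.r_mul _ _ _

theorem LeftAction.isEquivariant_anchor {M : EtaleGroupoid.{u}} {Y : Type u} [TopologicalSpace Y]
    (a : LeftAction M Y) : a.IsEquivariant (.obj M) a.anchor :=
  ⟨fun _ => rfl, fun g y e => a.anchor_act g y e⟩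

/-- An action on the arrow space of `H` that preserves the source map induces an action on the
space of composable pairs, through the first factor. -/
def LeftAction.pairs {M H : EtaleGroupoid.{u}} (a : LeftAction M H.Arr)
    (hs : ∀ g h e, H.s (a.act g h e) = H.s h) :
    LeftAction M {p : H.Arr × H.Arr // H.s p.1 = H.r p.2} where
  anchor p := a.anchor p.1.1
  act g p e := ⟨(a.act g p.1.1 e, p.1.2), (hs _ _ _).trans p.2⟩
  continuous_anchor := a.continuous_anchor.comp (continuous_fst.comp continuous_subtype_val)
  continuous_act := by
    refine Continuous.subtype_mk (Continuous.prodMk ?_ (by fun_prop)) _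
    exact a.continuous_act.comp (f := fun p : {p : M.Arr × {p : H.Arr × H.Arr // H.s p.1 = H.r p.2} //
      M.s p.1 = a.anchor p.2.1.1} => ⟨(p.1.1, p.1.2.1.1), p.2⟩)
      (Continuous.subtype_mk (by fun_prop) _)
  anchor_act g p e := a.anchor_act _ _ _
  one_act p := Subtype.ext (Prod.ext (a.one_act _) rfl)
  mul_act g h p e e' := Subtype.ext (Prod.ext (a.mul_act _ _ _ _ _) rfl)

/-- An action on the arrow space of `H` commutes with the right translation action. -/
structure LeftAction.CommutesRight {M H : EtaleGroupoid.{u}} (a : LeftAction M H.Arr) : Prop where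
  anchor_mul : ∀ h k e, a.anchor (H.mul h k e) = a.anchor h
  s_act : ∀ g h e, H.s (a.act g h e) = H.s h
  act_mul : ∀ g h k (e : M.s g = a.anchor h) (e' : H.s h = H.r k),
    H.mul (a.act g h e) k ((s_act g h e).trans e') =
      a.act g (H.mul h k e') (e.trans (anchor_mul h k e').symm)

variable {G : EtaleGroupoid.{u}} {X : GroupoidCorrespondence G G} {R : Set G.Obj}

/-- A `(G, X, R)`-action on the arrow space of `H` commutes with the right translation action. -/
structure CorrAction.CommutesRight {H : EtaleGroupoid.{u}} (c : CorrAction X R H.Arr) : Prop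
    extends LeftAction.CommutesRight c.toLeftAction where
  s_xact : ∀ x h e, H.s (c.xact x h e) = H.s h
  xact_mul : ∀ x h k (e : X.s x = c.anchor h) (e' : H.s h = H.r k),
    H.mul (c.xact x h e) k ((s_xact x h e).trans e') =
      c.xact x (H.mul h k e') (e.trans (anchor_mul h k e').symm)

namespace GroupoidModel

variable (𝓜 : GroupoidModel X R)

/-- The universal `(G, X, R)`-action, on the object space of the model. -/
def univ : CorrAction X R 𝓜.M.Obj := (𝓜.actionEquiv _).symm (.obj 𝓜.M)

theorem isEquivariant_anchor {Y : Type u} [TopologicalSpace Y] (c : CorrAction X R Y) :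
    c.IsEquivariant 𝓜.univ (𝓜.actionEquiv Y c).anchor := by
  rw [𝓜.natural _ _ _ _ _ (𝓜.actionEquiv Y c).continuous_anchor, univ, Equiv.apply_symm_apply]
  exact (𝓜.actionEquiv Y c).isEquivariant_anchor

/-- Uniqueness half of the terminality of `M⁰`: an `M`-equivariant map to `M⁰` must preserve
anchors, and the anchor map of `M⁰` is the identity. -/
theorem eq_anchor_of_isEquivariant {Y : Type u} [TopologicalSpace Y] (c : CorrAction X R Y)
    {φ : Y → 𝓜.M.Obj} (hφ : Continuous φ) (h : c.IsEquivariant 𝓜.univ φ) :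
    φ = (𝓜.actionEquiv Y c).anchor := by
  rw [𝓜.natural _ _ _ _ _ hφ, univ, Equiv.apply_symm_apply] at h
  exact funext h.1

section Invariant

variable (Z : Type u) [TopologicalSpace Z]

/-- The `(G, X, R)`-action on `Z × M⁰` that corresponds to the canonical action of `M`. -/
def univProd : CorrAction X R (Z × 𝓜.M.Obj) :=
  (𝓜.actionEquiv _).symm (.prodObj 𝓜.M Z)

theorem isEquivariant_snd : (𝓜.univProd Z).IsEquivariant 𝓜.univ Prod.snd := by
  rw [𝓜.natural _ _ _ _ _ continuous_snd, univ, univProd, Equiv.apply_symm_apply,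
    Equiv.apply_symm_apply]
  exact ⟨fun _ => rfl, fun _ _ _ => rfl⟩

/-- The slices `{z} × M⁰` are copies of the universal action. This computes the action on `Z × M⁰`
although the bijection of the model is not explicit. -/
theorem isEquivariant_prodMk (z : Z) : 𝓜.univ.IsEquivariant (𝓜.univProd Z) (Prod.mk z) := by
  rw [𝓜.natural _ _ _ _ _ (by fun_prop), univ, univProd, Equiv.apply_symm_apply,
    Equiv.apply_symm_apply]
  exact ⟨fun _ => rfl, fun _ _ _ => rfl⟩

theorem univProd_act (g : G.Arr) (p : Z × 𝓜.M.Obj) (e : G.s g = (𝓜.univProd Z).anchor p)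
    (e' : G.s g = 𝓜.univ.anchor p.2) :
    (𝓜.univProd Z).act g p e = (p.1, 𝓜.univ.act g p.2 e') :=
  let ⟨⟨_, h, _⟩, _⟩ := 𝓜.isEquivariant_prodMk Z p.1
  (h g p.2 e').symm

theorem univProd_xact (x : X.carrier) (p : Z × 𝓜.M.Obj) (e : X.s x = (𝓜.univProd Z).anchor p)
    (e' : X.s x = 𝓜.univ.anchor p.2) :
    (𝓜.univProd Z).xact x p e = (p.1, 𝓜.univ.xact x p.2 e') :=
  let ⟨⟨_, _, h⟩, _⟩ := 𝓜.isEquivariant_prodMk Z p.1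
  (h x p.2 e').symm

variable {Z}

/-- A continuous map is invariant under an action of the model if and only if it is invariant
under the corresponding `(G, X, R)`-action. -/
theorem invariant_iff {Y : Type u} [TopologicalSpace Y] (c : CorrAction X R Y) {f : Y → Z}
    (hf : Continuous f) :
    (∀ g y e, f ((𝓜.actionEquiv Y c).act g y e) = f y) ↔
      (∀ g y e, f (c.act g y e) = f y) ∧ ∀ x y e, f (c.xact x y e) = f y := by
  set a := 𝓜.actionEquiv Y c with ha
  obtain ⟨⟨hanc, hact, hxact⟩, him⟩ := 𝓜.isEquivariant_anchor c
  obtain ⟨⟨sanc, -, -⟩, sim⟩ := 𝓜.isEquivariant_snd Z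
  have hcont : Continuous fun y => (f y, a.anchor y) := hf.prodMk a.continuous_anchor
  -- Invariance becomes equivariance of a map into `Z × M⁰`, to which naturality applies.
  have key : (∀ g y e, f (a.act g y e) = f y) ↔
      a.IsEquivariant (.prodObj 𝓜.M Z) fun y => (f y, a.anchor y) :=
    ⟨fun h => ⟨fun _ => rfl, fun g y e => Prod.ext (h g y e) (a.anchor_act g y e)⟩,
      fun ⟨_, h⟩ g y e => congrArg Prod.fst (h g y e)⟩
  have nat := 𝓜.natural _ _ c (𝓜.univProd Z) _ hcont
  rw [univProd, Equiv.apply_symm_apply, ← ha, ← key] at nat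
  rw [← nat]
  constructor
  · rintro ⟨⟨e0, h1, h2⟩, -⟩
    refine ⟨fun g y e => ?_, fun x y e => ?_⟩
    · have := h1 g y e
      erw [𝓜.univProd_act Z g _ _ (e.trans (hanc y).symm)] at this
      exact congrArg Prod.fst this
    · have := h2 x y e
      erw [𝓜.univProd_xact Z x _ _ (e.trans (hanc y).symm)] at this
      exact congrArg Prod.fst this
  · rintro ⟨h1, h2⟩
    refine ⟨⟨fun y => (sanc _).symm.trans (hanc y), fun g y e => ?_, fun x y e => ?_⟩, ?_⟩
    · refine Eq.trans ?_ (𝓜.univProd_act Z g _ _ (e.trans (hanc y).symm)).symm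
      exact Prod.ext (h1 g y e) (hact g y e)
    · refine Eq.trans ?_ (𝓜.univProd_xact Z x _ _ (e.trans (hanc y).symm)).symm
      exact Prod.ext (h2 x y e) (hxact x y e)
    -- The condition on X-images is automatic: both images are preimages of `X · M⁰`, along the
    -- anchor map and along the second projection.
    · rw [← him]
      change _ ⁻¹' (𝓜.univProd Z).image = _
      rw [← sim]
      rfl

end Invariant

/-- Invariance of the source map is handled by `invariant_iff`; the rest of commutation is
equivariance of the multiplication map on composable pairs. -/
theorem commutesRight_iff {H : EtaleGroupoid.{u}} (c : CorrAction X R H.Arr) :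
    (𝓜.actionEquiv H.Arr c).CommutesRight ↔ c.CommutesRight := by
  set a := 𝓜.actionEquiv H.Arr c with ha
  have inv := 𝓜.invariant_iff c H.continuous_s
  rw [← ha] at inv
  -- The action on composable pairs exists only if `s` is invariant; otherwise both sides fail.
  by_cases hs : ∀ g h e, H.s (a.act g h e) = H.s h
  swap
  · exact ⟨fun h => (hs h.s_act).elim, fun h => (hs (inv.2 ⟨h.s_act, h.s_xact⟩)).elim⟩
  obtain ⟨hs1, hs2⟩ := inv.1 hs
  set P := {p : H.Arr × H.Arr // H.s p.1 = H.r p.2}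
  let d : CorrAction X R P := (𝓜.actionEquiv P).symm (a.pairs hs)
  have hd : 𝓜.actionEquiv P d = a.pairs hs := Equiv.apply_symm_apply _ _
  -- The (G,X,R)-action on pairs is determined by its two coordinates: the second projection is
  -- invariant and the first is equivariant.
  obtain ⟨dact, dxact⟩ := (𝓜.invariant_iff d (f := fun p : P => p.1.2) (by fun_prop)).1 <| by
    rw [hd]
    exact fun _ _ _ => rfl
  have hfst : d.IsEquivariant c fun p : P => p.1.1 := by
    rw [𝓜.natural _ _ _ _ _ (by fun_prop), hd, ← ha]
    exact ⟨fun _ => rfl, fun _ _ _ => rfl⟩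
  obtain ⟨⟨fanc, fact, fxact⟩, fim⟩ := hfst
  have dact' (g : G.Arr) (p : P) (e e') (e'') :
      d.act g p e = ⟨(c.act g p.1.1 e', p.1.2), e''⟩ :=
    Subtype.ext (Prod.ext (fact g p e) (dact g p e))
  have dxact' (x : X.carrier) (p : P) (e e') (e'') :
      d.xact x p e = ⟨(c.xact x p.1.1 e', p.1.2), e''⟩ :=
    Subtype.ext (Prod.ext (fxact x p e) (dxact x p e))
  have nat := 𝓜.natural _ _ d c (fun p : P => H.mul p.1.1 p.1.2 p.2) H.continuous_mul
  rw [hd, ← ha] at nat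
  have key : a.CommutesRight ↔
      (a.pairs hs).IsEquivariant a fun p : P => H.mul p.1.1 p.1.2 p.2 :=
    ⟨fun h => ⟨fun p => h.anchor_mul _ _ _, fun g p e => h.act_mul _ _ _ _ _⟩,
      fun ⟨h1, h2⟩ => ⟨fun h k e => h1 ⟨(h, k), e⟩, hs, fun g h k e e' => h2 g ⟨(h, k), e'⟩ e⟩⟩
  rw [key, ← nat]
  constructor
  · rintro ⟨⟨h0, h1, h2⟩, -⟩
    have hanc (h k : H.Arr) (e : H.s h = H.r k) : c.anchor (H.mul h k e) = c.anchor h :=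
      (h0 ⟨(h, k), e⟩).trans (fanc ⟨(h, k), e⟩).symm
    refine ⟨⟨hanc, hs1, fun g h k e e' => ?_⟩, hs2, fun x h k e e' => ?_⟩
    · have := h1 g ⟨(h, k), e'⟩ (e.trans (fanc ⟨(h, k), e'⟩))
      dsimp only at this
      rw [← this]
      refine H.mul_congr ?_ ?_ _ _
      · exact (fact g ⟨(h, k), e'⟩ _).symm
      · exact (dact g ⟨(h, k), e'⟩ _).symm
    · have := h2 x ⟨(h, k), e'⟩ (e.trans (fanc ⟨(h, k), e'⟩))
      dsimp only at this
      rw [← this]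
      refine H.mul_congr ?_ ?_ _ _
      · exact (fxact x ⟨(h, k), e'⟩ _).symm
      · exact (dxact x ⟨(h, k), e'⟩ _).symm
  · intro hc
    refine ⟨⟨fun p => (hc.anchor_mul _ _ _).trans (fanc p), fun g p e => ?_, fun x p e => ?_⟩, ?_⟩
    · rw [← hc.act_mul g p.1.1 p.1.2 (e.trans (fanc p).symm) p.2]
      exact H.mul_congr (fact g p e) (dact g p e) _ _
    · rw [← hc.xact_mul x p.1.1 p.1.2 (e.trans (fanc p).symm) p.2]
      exact H.mul_congr (fxact x p e) (dxact x p e) _ _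
    -- It remains to see that `hk ∈ X · H` if and only if `h ∈ X · H`; for one direction, translate
    -- by `k⁻¹`.
    · rw [← fim]
      ext ⟨⟨h, k⟩, e⟩
      change H.s h = H.r k at e
      constructor
      · rintro ⟨x, y, e1, h1⟩
        change H.mul h k e = _ at h1
        have e2 : H.s y = H.r (H.inv k) := by
          rw [H.r_inv, ← hc.s_xact x y e1, ← h1, H.s_mul]
        refine ⟨x, H.mul y (H.inv k) e2, e1.trans (hc.anchor_mul _ _ _).symm, ?_⟩
        rw [← hc.xact_mul x y _ e1 e2]
        exact (H.mul_inv_cancel_right h k e).symm.trans (H.mul_congr h1 rfl _ _)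
      · rintro ⟨x, y, e1, h1⟩
        change h = _ at h1
        subst h1
        have e2 : H.s y = H.r k := (hc.s_xact x y e1).symm.trans e
        exact ⟨x, H.mul y k e2, _, hc.xact_mul x y k e1 e2⟩

end GroupoidModel

/-! ### Topology over a discrete factor, and bisections as open embeddings. -/

theorem continuous_of_discrete_fst {D Y Z : Type*} [TopologicalSpace D] [TopologicalSpace Y]
    [TopologicalSpace Z] [DiscreteTopology D] {Q : D → Y → Prop}
    {f : {p : D × Y // Q p.1 p.2} → Z}
    (h : ∀ d, Continuous fun y : {y // Q d y} => f ⟨(d, y.1), y.2⟩) : Continuous f := by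
  rw [continuous_iff_continuousAt]
  intro p
  have ho : IsOpen {q : {p : D × Y // Q p.1 p.2} | q.1.1 = p.1.1} :=
    (isOpen_discrete {p.1.1}).preimage (continuous_fst.comp continuous_subtype_val)
  refine ContinuousOn.continuousAt ?_ (ho.mem_nhds rfl)
  rw [continuousOn_iff_continuous_domRestrict]
  have hc : Continuous fun q : {q : {p : D × Y // Q p.1 p.2} | q.1.1 = p.1.1} =>
      (⟨q.1.1.2, Eq.mp (congrArg (Q · q.1.1.2) q.2) q.1.2⟩ : {y // Q p.1.1 y}) :=
    Continuous.subtype_mk (by fun_prop) _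
  refine ((h p.1.1).comp hc).congr ?_
  rintro ⟨⟨⟨d, y⟩, hq⟩, hd⟩
  exact congrArg f (Subtype.ext (Prod.ext (Eq.symm hd) rfl))

theorem isOpenMap_of_discrete_fst {D Y Z : Type*} [TopologicalSpace D] [TopologicalSpace Y]
    [TopologicalSpace Z] {Q : D → Y → Prop} {f : {p : D × Y // Q p.1 p.2} → Z}
    (h : ∀ d, IsOpenMap fun y : {y // Q d y} => f ⟨(d, y.1), y.2⟩) : IsOpenMap f := by
  intro W hW
  have : f '' W = ⋃ d, (fun y : {y // Q d y} => f ⟨(d, y.1), y.2⟩) ''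
      ((fun y : {y // Q d y} => (⟨(d, y.1), y.2⟩ : {p : D × Y // Q p.1 p.2})) ⁻¹' W) := by
    ext z
    simp only [mem_iUnion, mem_image, mem_preimage]
    constructor
    · rintro ⟨p, hp, rfl⟩
      exact ⟨p.1.1, ⟨p.1.2, p.2⟩, hp, rfl⟩
    · rintro ⟨d, y, hy, rfl⟩
      exact ⟨_, hy, rfl⟩
  rw [this]
  exact isOpen_iUnion fun d => h d _ (hW.preimage (Continuous.subtype_mk (by fun_prop) _))

namespace EtaleGroupoid

variable {H : EtaleGroupoid.{u}}

/-- The composite with `s` is the inclusion of an open set, hence étale; so the section is étale and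
therefore open. -/
theorem isOpen_range_section {U : Set H.Obj} (hU : IsOpen U) {σ : U → H.Arr}
    (hσ : Continuous σ) (hs : ∀ ω, H.s (σ ω) = ω) : IsOpen (range σ) := by
  refine (H.isLocalHomeomorph_of_s_comp hσ ?_).isOpenMap.isOpen_range
  rw [show H.s ∘ σ = Subtype.val from funext hs]
  exact hU.isOpenEmbedding_subtypeVal.isLocalHomeomorph

theorem IsBisection.isOpenEmbedding {S : Set H.Arr} (hS : H.IsBisection S) :
    Topology.IsOpenEmbedding fun t : S => H.s t :=
  (H.isLocalHomeomorph_s.comp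
    hS.1.isOpenEmbedding_subtypeVal.isLocalHomeomorph).isOpenEmbedding_of_injective
    fun _ _ h => Subtype.ext (hS.2.2 (Subtype.prop _) (Subtype.prop _) h)

/-- A lift along the source map into a bisection is continuous. -/
theorem IsBisection.continuous_lift {S : Set H.Arr} (hS : H.IsBisection S) {T : Type*}
    [TopologicalSpace T] {f : T → H.Arr} (hf : ∀ t, f t ∈ S) (hs : Continuous fun t => H.s (f t)) :
    Continuous f :=
  continuous_subtype_val.comp
    ((hS.isOpenEmbedding.isInducing.continuous_iff (f := fun t => (⟨f t, hf t⟩ : S))).2 hs)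

end EtaleGroupoid

/-! ### From actions to families of bisections. -/

/-- The source map on `G ⊔ X`. -/
def GroupoidCorrespondence.src (X : GroupoidCorrespondence G G) : G.Arr ⊕ X.carrier → G.Obj :=
  Sum.elim G.s X.s

/-- The range map on `G ⊔ X`. -/
def GroupoidCorrespondence.tgt (X : GroupoidCorrespondence G G) : G.Arr ⊕ X.carrier → G.Obj :=
  Sum.elim G.r X.r

namespace CorrAction

section Rel

variable {Y : Type u} [TopologicalSpace Y] (c : CorrAction X R Y)

/-- The relation `k = z · h` for `z ∈ G ⊔ X`. -/
def Rel : G.Arr ⊕ X.carrier → Y → Y → Prop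
  | .inl g, h, k => ∃ e, k = c.act g h e
  | .inr x, h, k => ∃ e, k = c.xact x h e

variable {c} {z : G.Arr ⊕ X.carrier} {h h' k k' : Y}

theorem Rel.src_eq (H : c.Rel z h k) : X.src z = c.anchor h := by
  rcases z with g | x <;> exact H.1

theorem Rel.anchor_eq (H : c.Rel z h k) : c.anchor k = X.tgt z := by
  rcases z with g | x
  · obtain ⟨e, rfl⟩ := H
    exact c.anchor_act g h e
  · obtain ⟨e, rfl⟩ := H
    exact c.anchor_xact x h e

theorem exists_rel (e : X.src z = c.anchor h) : ∃ k, c.Rel z h k := by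
  rcases z with g | x
  · exact ⟨_, e, rfl⟩
  · exact ⟨_, e, rfl⟩

theorem Rel.right_unique (h₁ : c.Rel z h k) (h₂ : c.Rel z h k') : k = k' := by
  rcases z with g | x <;> exact h₁.2.trans h₂.2.symm

theorem rel_inl_one {v : G.Obj} : c.Rel (.inl (G.one v)) h k ↔ v = c.anchor h ∧ k = h := by
  constructor
  · rintro ⟨e, rfl⟩
    obtain rfl : v = c.anchor h := (G.s_one v).symm.trans e
    exact ⟨rfl, c.one_act h⟩
  · rintro ⟨rfl, rfl⟩
    exact ⟨G.s_one _, (c.one_act _).symm⟩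

theorem rel_mul (g g' : G.Arr) (e : G.s g = G.r g') :
    (∃ b, c.Rel (.inl g') h b ∧ c.Rel (.inl g) b k) ↔ c.Rel (.inl (G.mul g g' e)) h k := by
  constructor
  · rintro ⟨_, ⟨e₁, rfl⟩, e₂, rfl⟩
    exact ⟨_, (c.mul_act g g' h e e₁).symm⟩
  · rintro ⟨e₁, rfl⟩
    exact ⟨_, ⟨(G.s_mul g g' e).symm.trans e₁, rfl⟩, _, c.mul_act g g' h e _⟩

theorem rel_lmul (g : G.Arr) (x : X.carrier) (e : G.s g = X.r x) :
    (∃ b, c.Rel (.inr x) h b ∧ c.Rel (.inl g) b k) ↔ c.Rel (.inr (X.lmul g x e)) h k := by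
  constructor
  · rintro ⟨_, ⟨e₁, rfl⟩, e₂, rfl⟩
    exact ⟨_, c.act_xact g x h e e₁⟩
  · rintro ⟨e₁, rfl⟩
    exact ⟨_, ⟨(X.right_anchor_left_act g x e).symm.trans e₁, rfl⟩, _,
      (c.act_xact g x h e _).symm⟩

theorem rel_rmul (x : X.carrier) (g : G.Arr) (e : X.s x = G.r g) :
    (∃ b, c.Rel (.inl g) h b ∧ c.Rel (.inr x) b k) ↔ c.Rel (.inr (X.rmul x g e)) h k := by
  have hs : X.s (X.rmul x g e) = G.s g := X.right.anchor_act x g e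
  constructor
  · rintro ⟨_, ⟨e₁, rfl⟩, e₂, rfl⟩
    exact ⟨hs.trans e₁, (c.xact_eq_iff _ _ _ _ _ _).2 ⟨g, e, e₁, rfl, rfl⟩⟩
  · rintro ⟨e₁, rfl⟩
    have e₂ := hs.symm.trans e₁
    exact ⟨_, ⟨e₂, rfl⟩, e.trans (c.anchor_act _ _ _).symm,
      ((c.xact_eq_iff _ _ _ _ _ _).2 ⟨g, e, e₂, rfl, rfl⟩).symm⟩

/-- Arrows of `G` act invertibly. For `x ∈ X`, axiom (b) gives `g` with `x · g = x`, and freeness of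
the right action makes `g` a unit. -/
theorem Rel.left_unique (h₁ : c.Rel z h k) (h₂ : c.Rel z h' k) : h = h' := by
  rcases z with g | x
  · have key (y : Y) (hy : c.Rel (.inl g) y k) : c.Rel (.inl (G.inv g)) k y := by
      obtain ⟨b, hb⟩ := exists_rel (c := c) (z := .inl (G.inv g)) (h := k)
        ((G.s_inv g).trans hy.anchor_eq.symm)
      have := (rel_mul (G.inv g) g (G.s_inv g)).1 ⟨k, hy, hb⟩
      rw [G.inv_mul, rel_inl_one] at this
      exact this.2 ▸ hb
    exact (key _ h₁).right_unique (key _ h₂)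
  · obtain ⟨e₁, h₁⟩ := h₁
    obtain ⟨e₂, h₂⟩ := h₂
    obtain ⟨g, e₃, e₄, h₃, h₄⟩ := (c.xact_eq_iff _ _ _ _ _ _).1 (h₁.symm.trans h₂)
    have hg : g = G.one (X.s x) := X.right_free x g e₃ h₃.symm
    exact (rel_inl_one.1 (hg ▸ ⟨e₄, h₄⟩ : c.Rel (.inl (G.one (X.s x))) h' h)).2

theorem sameOrbit_of_rel {x x' : X.carrier} (h₁ : c.Rel (.inr x) h k)
    (h₂ : c.Rel (.inr x') h' k) : X.SameOrbit x x' := by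
  obtain ⟨e₁, h₁⟩ := h₁
  obtain ⟨e₂, h₂⟩ := h₂
  obtain ⟨g, e₃, e₄, h₃, h₄⟩ := (c.xact_eq_iff _ _ _ _ _ _).1 (h₁.symm.trans h₂)
  exact ⟨g, e₃, h₃⟩

end Rel

variable {H : EtaleGroupoid.{u}} {c : CorrAction X R H.Arr}

theorem actsByFamily_iff {θ : G.Arr ⊕ X.carrier → H.Bisection} :
    ActsByFamily c θ ↔ ∀ z h k, c.Rel z h k ↔
      ∃ t ∈ (θ z).1, ∃ e : H.s t = H.r h, k = H.mul t h e :=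
  ⟨fun ⟨h₁, h₂⟩ z => by rcases z with g | x; exacts [h₁ g, h₂ x],
    fun h => ⟨fun g => h (.inl g), fun x => h (.inr x)⟩⟩

/-- Letting `z` act on units recovers the bisection, so the action determines the family. -/
theorem mem_of_actsByFamily {θ : G.Arr ⊕ X.carrier → H.Bisection} (hθ : ActsByFamily c θ)
    (z : G.Arr ⊕ X.carrier) (t : H.Arr) : t ∈ (θ z).1 ↔ c.Rel z (H.one (H.s t)) t := by
  rw [actsByFamily_iff.1 hθ]
  constructor
  · intro ht
    exact ⟨t, ht, (H.r_one _).symm, (H.mul_one t).symm⟩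
  · rintro ⟨t', ht', e, h⟩
    rw [H.mul_one'] at h
    exact h ▸ ht'

/-- The set of arrows by which `z ∈ G ⊔ X` acts. -/
def famSet (c : CorrAction X R H.Arr) (z : G.Arr ⊕ X.carrier) : Set H.Arr :=
  {t | c.Rel z (H.one (H.s t)) t}

end CorrAction

namespace CorrAction.CommutesRight

variable {H : EtaleGroupoid.{u}} {c : CorrAction X R H.Arr} {z w : G.Arr ⊕ X.carrier} {h k : H.Arr}

theorem s_eq (hc : c.CommutesRight) (hk : c.Rel z h k) : H.s k = H.s h := by
  rcases z with g | x
  · obtain ⟨e, rfl⟩ := hk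
    exact hc.s_act g h e
  · obtain ⟨e, rfl⟩ := hk
    exact hc.s_xact x h e

theorem rel_mul_right (hc : c.CommutesRight) (hk : c.Rel z h k) (m : H.Arr) (e : H.s h = H.r m)
    (e' : H.s k = H.r m) : c.Rel z (H.mul h m e) (H.mul k m e') := by
  rcases z with g | x
  · obtain ⟨e₁, rfl⟩ := hk
    exact ⟨_, hc.act_mul g h m e₁ e⟩
  · obtain ⟨e₁, rfl⟩ := hk
    exact ⟨_, hc.xact_mul x h m e₁ e⟩

/-- If `k = z · h`, then translating by `h⁻¹` gives `k h⁻¹ = z · 1_{r(h)}`, and this is the required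
`t`. -/
theorem rel_iff (hc : c.CommutesRight) :
    c.Rel z h k ↔ ∃ t ∈ c.famSet z, ∃ e : H.s t = H.r h, k = H.mul t h e := by
  constructor
  · intro hk
    have hs := hc.s_eq hk
    have e₁ : H.s k = H.r (H.inv h) := hs.trans (H.r_inv h).symm
    have h₁ := hc.rel_mul_right hk (H.inv h) (H.r_inv h).symm e₁
    have e₂ : H.s (H.mul k (H.inv h) e₁) = H.r h := (H.s_mul _ _ _).trans (H.s_inv h)
    refine ⟨H.mul k (H.inv h) e₁, ?_, e₂, ?_⟩
    · rwa [famSet, mem_ofPred_eq, e₂, ← H.mul_inv]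
    · rw [H.mul_assoc k (H.inv h) h e₁ (H.s_inv h)]
      refine Eq.trans ?_ (H.mul_congr rfl (H.inv_mul h).symm (hs.trans (H.r_one _).symm) _)
      exact (H.mul_one' _).symm
  · rintro ⟨t, ht, e, rfl⟩
    have := hc.rel_mul_right ht h ((H.s_one _).trans e) e
    rwa [H.one_mul'] at this

theorem mem_setMul (hc : c.CommutesRight) :
    k ∈ H.setMul (c.famSet z) (c.famSet w) ↔
      ∃ b, c.Rel w (H.one (H.s k)) b ∧ c.Rel z b k := by
  constructor
  · rintro ⟨a, ha, b, hb, e, rfl⟩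
    exact ⟨b, (H.s_mul a b e).symm ▸ hb, hc.rel_iff.2 ⟨a, ha, e, rfl⟩⟩
  · rintro ⟨b, hb, hk⟩
    obtain ⟨a, ha, e, rfl⟩ := hc.rel_iff.1 hk
    refine ⟨a, ha, b, ?_, e, rfl⟩
    rwa [H.s_mul] at hb

theorem mem_setStar_setMul (hc : c.CommutesRight) :
    k ∈ H.setMul (H.setStar (c.famSet z)) (c.famSet w) ↔
      ∃ b, c.Rel w (H.one (H.s k)) b ∧ c.Rel z k b := by
  constructor
  · rintro ⟨_, ⟨a, ha, rfl⟩, b, hb, e, rfl⟩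
    refine ⟨b, (H.s_mul (H.inv a) b e).symm ▸ hb, hc.rel_iff.2 ⟨a, ha, ?_, ?_⟩⟩
    · rw [H.r_mul, H.r_inv]
    · exact (H.mul_inv_cancel_left a b ((H.s_inv a).symm.trans e)).symm
  · rintro ⟨b, hb, hk⟩
    obtain ⟨a, ha, e, rfl⟩ := hc.rel_iff.1 hk
    refine ⟨H.inv a, ⟨a, ha, rfl⟩, H.mul a k e, ?_, ?_, (H.inv_mul_cancel_left a k e).symm⟩
    · rwa [famSet, mem_ofPred_eq, H.s_mul]
    · rw [H.s_inv, H.r_mul]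

theorem isOpen_famSet (hc : c.CommutesRight) (hG : DiscreteTopology G.Arr) :
    IsOpen (c.famSet z) := by
  have := G.discreteTopology_obj hG
  have hcont : Continuous fun ω => c.anchor (H.one ω) :=
    c.continuous_anchor.comp H.continuous_one
  have hU : IsOpen {ω | X.src z = c.anchor (H.one ω)} :=
    (isOpen_discrete {v | X.src z = v}).preimage hcont
  -- The set is the range of the section `ω ↦ z · 1_ω`, whose domain is open because `G⁰` is
  -- discrete.
  have key (σ : {ω | X.src z = c.anchor (H.one ω)} → H.Arr) (hσ : Continuous σ)
      (h : ∀ ω : {ω | X.src z = c.anchor (H.one ω)}, c.Rel z (H.one ω) (σ ω)) :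
      IsOpen (c.famSet z) := by
    have hs (ω) : H.s (σ ω) = ω := (hc.s_eq (h ω)).trans (H.s_one _)
    convert EtaleGroupoid.isOpen_range_section hU hσ hs
    ext t
    constructor
    · intro ht
      exact ⟨⟨H.s t, ht.src_eq⟩, (h ⟨H.s t, _⟩).right_unique ht⟩
    · rintro ⟨ω, rfl⟩
      have := h ω
      rwa [← hs ω] at this
  rcases z with g | x
  · refine key (fun ω => c.act g (H.one ω) ω.2) ?_ fun ω => ⟨_, rfl⟩
    refine c.continuous_act.comp
      (f := fun ω : {ω | X.src (.inl g) = c.anchor (H.one ω)} => ⟨(g, H.one ω), ω.2⟩) ?_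
    have := H.continuous_one
    exact Continuous.subtype_mk (by fun_prop) _
  · refine key (fun ω => c.xact x (H.one ω) ω.2) ?_ fun ω => ⟨_, rfl⟩
    refine c.continuous_xact.comp
      (f := fun ω : {ω | X.src (.inr x) = c.anchor (H.one ω)} => ⟨(x, H.one ω), ω.2⟩) ?_
    have := H.continuous_one
    exact Continuous.subtype_mk (by fun_prop) _

theorem isBisection_famSet (hc : c.CommutesRight) (hG : DiscreteTopology G.Arr) :
    H.IsBisection (c.famSet z) := by
  refine ⟨hc.isOpen_famSet hG, fun t ht t' ht' hr => ?_, fun t ht t' ht' hs => ?_⟩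
  -- Here `z` sends both `t⁻¹ t'` and the unit at `s(t')` to `t'`. As `z` acts injectively, `t⁻¹ t'`
  -- is a unit.
  · have e : H.s (H.inv t) = H.r t' := (H.s_inv t).trans hr
    have h₁ : c.Rel z (H.mul (H.inv t) t' e) t' := hc.rel_iff.2
      ⟨t, ht, (H.r_inv t).symm.trans (H.r_mul _ _ _).symm, (H.mul_inv_cancel_left t t' hr).symm⟩
    have h₂ := h₁.left_unique ht'
    rw [← H.mul_inv_cancel_left t t' hr]
    refine (H.mul_one t).symm.trans (H.mul_congr rfl (h₂.trans ?_).symm _ _)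
    have h₃ := congrArg H.r h₂
    rw [H.r_mul, H.r_inv, H.r_one] at h₃
    rw [h₃]
  · change c.Rel z _ _ at ht ht'
    rw [hs] at ht
    exact ht.right_unique ht'

/-- The family of bisections of an action that commutes with right translations. -/
def family (hc : c.CommutesRight) (hG : DiscreteTopology G.Arr) (z : G.Arr ⊕ X.carrier) :
    H.Bisection :=
  ⟨c.famSet z, hc.isBisection_famSet hG⟩

theorem actsByFamily (hc : c.CommutesRight) (hG : DiscreteTopology G.Arr) :
    ActsByFamily c (hc.family hG) :=
  CorrAction.actsByFamily_iff.2 fun _ _ _ => hc.rel_iff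

theorem one_mem_famSet_iff {v : G.Obj} {ω : H.Obj} :
    H.one ω ∈ c.famSet (.inl (G.one v)) ↔ v = c.anchor (H.one ω) := by
  rw [famSet, mem_ofPred_eq, H.s_one, CorrAction.rel_inl_one, and_iff_left rfl]

theorem famSet_inl_one (v : G.Obj) :
    c.famSet (.inl (G.one v)) = H.one '' {ω | v = c.anchor (H.one ω)} := by
  ext t
  constructor
  · intro ht
    obtain ⟨h₁, h₂⟩ := CorrAction.rel_inl_one.1 ht
    exact ⟨H.s t, h₁, h₂.symm⟩
  · rintro ⟨ω, h, rfl⟩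
    exact one_mem_famSet_iff.2 h

theorem isPreActorFamily (hc : c.CommutesRight) (hG : DiscreteTopology G.Arr) :
    IsPreActorFamily R (hc.family hG) where
  mul_arr_arr g g' e := by
    ext k
    exact (hc.mem_setMul (z := .inl g) (w := .inl g')).trans (CorrAction.rel_mul g g' e)
  mul_arr_arr_empty g g' hne := by
    ext k
    refine iff_of_false (fun hk => ?_) id
    obtain ⟨b, h₁, h₂⟩ := (hc.mem_setMul (z := .inl g) (w := .inl g')).1 hk
    exact hne (h₂.src_eq.trans h₁.anchor_eq)
  mul_arr_corr g x e := by
    ext k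
    exact (hc.mem_setMul (z := .inl g) (w := .inr x)).trans (CorrAction.rel_lmul g x e)
  mul_arr_corr_empty g x hne := by
    ext k
    refine iff_of_false (fun hk => ?_) id
    obtain ⟨b, h₁, h₂⟩ := (hc.mem_setMul (z := .inl g) (w := .inr x)).1 hk
    exact hne (h₂.src_eq.trans h₁.anchor_eq)
  mul_corr_arr x g e := by
    ext k
    exact (hc.mem_setMul (z := .inr x) (w := .inl g)).trans (CorrAction.rel_rmul x g e)
  mul_corr_arr_empty x g hne := by
    ext k
    refine iff_of_false (fun hk => ?_) id
    obtain ⟨b, h₁, h₂⟩ := (hc.mem_setMul (z := .inr x) (w := .inl g)).1 hk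
    exact hne (h₂.src_eq.trans h₁.anchor_eq)
  star_mul_self x := by
    ext k
    refine (hc.mem_setStar_setMul (z := .inr x) (w := .inr x)).trans ⟨?_, fun hk => ?_⟩
    · rintro ⟨b, h₁, h₂⟩
      exact CorrAction.rel_inl_one.2 ⟨h₁.src_eq, h₂.left_unique h₁⟩
    · obtain ⟨h₁, h₂⟩ := CorrAction.rel_inl_one.1 hk
      obtain ⟨b, hb⟩ := CorrAction.exists_rel (z := .inr x) h₁
      exact ⟨b, hb, h₂ ▸ hb⟩
  star_mul_empty x y hne := by
    ext k
    refine iff_of_false (fun hk => ?_) id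
    obtain ⟨b, h₁, h₂⟩ := (hc.mem_setStar_setMul (z := .inr x) (w := .inr y)).1 hk
    exact hne (CorrAction.sameOrbit_of_rel h₂ h₁)
  cover ω := ⟨_, _, one_mem_famSet_iff.2 rfl, H.s_one ω⟩
  cover_regular v hv := by
    rintro _ ⟨t, ht, rfl⟩
    obtain ⟨x, y, e, h⟩ := c.exists_xact_of_mem (H.one (H.s t))
      ((CorrAction.rel_inl_one.1 ht).1 ▸ hv)
    obtain ⟨a, ha, e', h'⟩ := (hc.rel_iff (z := .inr x)).1 ⟨e, h⟩
    refine mem_iUnion.2 ⟨x, a, ha, ?_⟩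
    rw [← H.r_mul a y e', ← h', H.r_one]

theorem hasClosedCodomains (hc : c.CommutesRight) (hG : DiscreteTopology G.Arr) :
    HasClosedCodomains (hc.family hG) := by
  intro x
  -- Axiom (d) for a single orbit, restricted to units: `1_ω` is a product with a representative of
  -- the orbit exactly when `ω` is in the codomain of `θ x`.
  have hcl := (c.isClosed_xact {Quotient.mk _ x} isCompact_singleton).preimage H.continuous_one
  convert hcl
  ext ω
  simp only [mem_singleton_iff, mem_preimage, mem_ofPred_eq]
  constructor
  · rintro ⟨t, ht, rfl⟩
    have e := H.r_inv t
    obtain ⟨e₁, h₁⟩ := (hc.rel_iff (z := .inr x) (h := H.inv t) (k := H.one (H.r t))).2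
      ⟨t, ht, e.symm, (H.mul_inv t).symm⟩
    exact ⟨x, _, e₁, rfl, h₁⟩
  · rintro ⟨x', y, e, hx, h⟩
    obtain ⟨g, eg, rfl⟩ : X.SameOrbit x x' := Quotient.exact hx.symm
    obtain ⟨b, -, hb⟩ := (CorrAction.rel_rmul x g eg).2 ⟨e, h⟩
    obtain ⟨t, ht, e₁, h₁⟩ := hc.rel_iff.1 hb
    exact ⟨t, ht, by rw [← H.r_mul t b e₁, ← h₁, H.r_one]⟩

end CorrAction.CommutesRight

/-- In an orbit space over a discrete groupoid, every compact set is finite. -/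
theorem GroupoidCorrespondence.finite_of_isCompact (hG : DiscreteTopology G.Arr)
    {K : Set X.Orbits} (hK : IsCompact K) : K.Finite := by
  have := X.discreteTopology hG
  have : DiscreteTopology X.Orbits :=
    discreteTopology_iff_forall_isOpen.2 fun _ => isOpen_coinduced.2 (isOpen_discrete _)
  exact hK.finite_of_discrete

/-! ### From families of bisections to actions. -/

namespace IsPreActorFamily

variable {H : EtaleGroupoid.{u}} {θ : G.Arr ⊕ X.carrier → H.Bisection}

/-- Since `θ v` is its own square, `t = ab` with `a, b ∈ θ v`. Injectivity of `r` and `s` forces `a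
= t = b`, so `t` is idempotent, hence a unit. -/
theorem eq_one (hθ : IsPreActorFamily R θ) {v : G.Obj} {t : H.Arr}
    (ht : t ∈ (θ (.inl (G.one v))).1) : t = H.one (H.s t) := by
  set S := (θ (.inl (G.one v))) with hS
  have h := hθ.mul_arr_arr (G.one v) (G.one v) ((G.s_one v).trans (G.r_one v).symm)
  rw [G.one_mul', ← hS] at h
  have ht' := ht
  rw [← h] at ht'
  obtain ⟨a, ha, b, hb, e, h'⟩ := ht'
  have h₁ : a = t := S.2.2.1 ha ht (by rw [h', H.r_mul])
  have h₂ : b = t := S.2.2.2 hb ht (by rw [h', H.s_mul])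
  subst h₁
  subst h₂
  exact H.eq_one_of_mul_self h'.symm

theorem one_mem_iff (hθ : IsPreActorFamily R θ) {v : G.Obj} {ω : H.Obj} :
    H.one ω ∈ (θ (.inl (G.one v))).1 ↔ ω ∈ H.s '' (θ (.inl (G.one v))).1 := by
  constructor
  · intro h
    exact ⟨_, h, H.s_one ω⟩
  · rintro ⟨t, ht, rfl⟩
    rwa [← hθ.eq_one ht]

theorem exists_vertex (hθ : IsPreActorFamily R θ) (ω : H.Obj) :
    ∃ v, H.one ω ∈ (θ (.inl (G.one v))).1 :=
  (hθ.cover ω).imp fun _ h => hθ.one_mem_iff.2 h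

/-- The object of `G` over which an object of `H` lies. -/
noncomputable def vertex (hθ : IsPreActorFamily R θ) (ω : H.Obj) : G.Obj :=
  (hθ.exists_vertex ω).choose

theorem one_mem_vertex (hθ : IsPreActorFamily R θ) (ω : H.Obj) :
    H.one ω ∈ (θ (.inl (G.one (hθ.vertex ω)))).1 :=
  (hθ.exists_vertex ω).choose_spec

theorem one_mem_iff_eq_vertex (hθ : IsPreActorFamily R θ) {v : G.Obj} {ω : H.Obj} :
    H.one ω ∈ (θ (.inl (G.one v))).1 ↔ v = hθ.vertex ω := by
  refine ⟨fun h => ?_, fun h => h ▸ hθ.one_mem_vertex ω⟩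
  -- A unit lying in two different sets `θ v` would be in their product, which condition 1 makes
  -- empty.
  by_contra hne
  have h₁ := hθ.mul_arr_arr_empty (G.one v) (G.one (hθ.vertex ω)) <| by
    rwa [G.s_one, G.r_one]
  refine (h₁.subset ⟨_, h, _, hθ.one_mem_vertex ω, (H.s_one ω).trans (H.r_one ω).symm, ?_⟩ :
    H.one ω ∈ (∅ : Set H.Arr))
  exact (H.one_mul' _).symm

theorem vertex_r (hθ : IsPreActorFamily R θ) {z : G.Arr ⊕ X.carrier} {t : H.Arr}
    (ht : t ∈ (θ z).1) : hθ.vertex (H.r t) = X.tgt z := by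
  have key : H.setMul (θ (.inl (G.one (X.tgt z)))).1 (θ z).1 = (θ z).1 := by
    rcases z with g | x
    · exact (hθ.mul_arr_arr _ _ (G.s_one _)).trans <|
        congrArg (fun g => (θ (.inl g)).1) (G.one_mul' _)
    · exact (hθ.mul_arr_corr _ _ (G.s_one _)).trans <|
        congrArg (fun x => (θ (.inr x)).1) (X.left.one_act x)
  rw [← key] at ht
  obtain ⟨a, ha, b, hb, e, rfl⟩ := ht
  have h₁ := hθ.eq_one ha
  rw [h₁, hθ.one_mem_iff_eq_vertex] at ha
  rw [H.r_mul, ha, h₁, H.s_one, H.r_one]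

theorem vertex_s (hθ : IsPreActorFamily R θ) {z : G.Arr ⊕ X.carrier} {t : H.Arr}
    (ht : t ∈ (θ z).1) : X.src z = hθ.vertex (H.s t) := by
  have key : H.setMul (θ z).1 (θ (.inl (G.one (X.src z)))).1 = (θ z).1 := by
    rcases z with g | x
    · exact (hθ.mul_arr_arr _ _ (G.r_one _).symm).trans <|
        congrArg (fun g => (θ (.inl g)).1) (G.mul_one' _)
    · exact (hθ.mul_corr_arr _ _ (G.r_one _).symm).trans <|
        congrArg (fun x => (θ (.inr x)).1) (X.right.act_one x)
  rw [← key] at ht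
  obtain ⟨a, ha, b, hb, e, rfl⟩ := ht
  rw [hθ.eq_one hb, hθ.one_mem_iff_eq_vertex] at hb
  rw [H.s_mul, hb]

/-- The unit at `ω` factors through `θ (g⁻¹) θ g` or `(θ x)* θ x`; the right factor has source `ω`.
-/
theorem exists_mem_of_vertex (hθ : IsPreActorFamily R θ) {z : G.Arr ⊕ X.carrier} {ω : H.Obj}
    (h : X.src z = hθ.vertex ω) : ∃ t ∈ (θ z).1, H.s t = ω := by
  have hω := hθ.one_mem_iff_eq_vertex.2 h
  rcases z with g | x
  · have h₁ := hθ.mul_arr_arr (G.inv g) g (G.s_inv g)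
    rw [G.inv_mul] at h₁
    change H.one ω ∈ (θ (.inl (G.one (G.s g)))).1 at hω
    rw [← h₁] at hω
    obtain ⟨a, ha, b, hb, e, h'⟩ := hω
    exact ⟨b, hb, by rw [← H.s_mul a b e, ← h', H.s_one]⟩
  · change H.one ω ∈ (θ (.inl (G.one (X.s x)))).1 at hω
    rw [← hθ.star_mul_self] at hω
    obtain ⟨a, ha, b, hb, e, h'⟩ := hω
    exact ⟨b, hb, by rw [← H.s_mul a b e, ← h', H.s_one]⟩

/-- The arrow in `θ z` with source `ω`. -/
noncomputable def lift (hθ : IsPreActorFamily R θ) (z : G.Arr ⊕ X.carrier) (ω : H.Obj)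
    (h : X.src z = hθ.vertex ω) : H.Arr :=
  (hθ.exists_mem_of_vertex h).choose

theorem lift_mem (hθ : IsPreActorFamily R θ) (z : G.Arr ⊕ X.carrier) (ω : H.Obj)
    (h : X.src z = hθ.vertex ω) : hθ.lift z ω h ∈ (θ z).1 :=
  (hθ.exists_mem_of_vertex h).choose_spec.1

theorem s_lift (hθ : IsPreActorFamily R θ) (z : G.Arr ⊕ X.carrier) (ω : H.Obj)
    (h : X.src z = hθ.vertex ω) : H.s (hθ.lift z ω h) = ω :=
  (hθ.exists_mem_of_vertex h).choose_spec.2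

/-- The product `z · h`. -/
noncomputable def mulArr (hθ : IsPreActorFamily R θ) (z : G.Arr ⊕ X.carrier) (h : H.Arr)
    (e : X.src z = hθ.vertex (H.r h)) : H.Arr :=
  H.mul (hθ.lift z (H.r h) e) h (hθ.s_lift _ _ _)

theorem s_mulArr (hθ : IsPreActorFamily R θ) (z : G.Arr ⊕ X.carrier) (h : H.Arr)
    (e : X.src z = hθ.vertex (H.r h)) : H.s (hθ.mulArr z h e) = H.s h :=
  H.s_mul _ _ _

theorem vertex_r_mulArr (hθ : IsPreActorFamily R θ) (z : G.Arr ⊕ X.carrier) (h : H.Arr)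
    (e : X.src z = hθ.vertex (H.r h)) : hθ.vertex (H.r (hθ.mulArr z h e)) = X.tgt z := by
  rw [mulArr, H.r_mul]
  exact hθ.vertex_r (hθ.lift_mem _ _ _)

theorem eq_mulArr (hθ : IsPreActorFamily R θ) {z : G.Arr ⊕ X.carrier} {t h : H.Arr}
    (ht : t ∈ (θ z).1) (e : H.s t = H.r h) (e' : X.src z = hθ.vertex (H.r h)) :
    H.mul t h e = hθ.mulArr z h e' :=
  H.mul_congr ((θ z).2.2.2 ht (hθ.lift_mem _ _ _) (e.trans (hθ.s_lift _ _ _).symm)) rfl _ _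

theorem mulArr_rel_iff (hθ : IsPreActorFamily R θ) {z : G.Arr ⊕ X.carrier} {h k : H.Arr} :
    (∃ e, k = hθ.mulArr z h e) ↔ ∃ t ∈ (θ z).1, ∃ e : H.s t = H.r h, k = H.mul t h e := by
  constructor
  · rintro ⟨e, rfl⟩
    exact ⟨_, hθ.lift_mem _ _ _, _, rfl⟩
  · rintro ⟨t, ht, e, rfl⟩
    exact ⟨(hθ.vertex_s ht).trans (congrArg _ e), hθ.eq_mulArr ht e _⟩

theorem mulArr_mulArr (hθ : IsPreActorFamily R θ) {z w y : G.Arr ⊕ X.carrier}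
    (hy : H.setMul (θ z).1 (θ w).1 = (θ y).1) {h : H.Arr} (e : X.src w = hθ.vertex (H.r h))
    (e' : X.src z = hθ.vertex (H.r (hθ.mulArr w h e))) (e'' : X.src y = hθ.vertex (H.r h)) :
    hθ.mulArr z (hθ.mulArr w h e) e' = hθ.mulArr y h e'' := by
  have e₁ : H.s (hθ.lift z _ e') = H.r (hθ.lift w _ e) :=
    (hθ.s_lift _ _ _).trans (H.r_mul _ _ _)
  have hm : H.mul (hθ.lift z _ e') (hθ.lift w _ e) e₁ ∈ (θ y).1 :=
    hy ▸ ⟨_, hθ.lift_mem _ _ _, _, hθ.lift_mem _ _ _, e₁, rfl⟩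
  rw [← hθ.eq_mulArr hm ((H.s_mul _ _ _).trans (hθ.s_lift _ _ _)),
    H.mul_assoc _ _ _ e₁ (hθ.s_lift _ _ _)]
  rfl

theorem mulArr_one (hθ : IsPreActorFamily R θ) (h : H.Arr)
    (e : X.src (.inl (G.one (hθ.vertex (H.r h)))) = hθ.vertex (H.r h)) :
    hθ.mulArr (.inl (G.one (hθ.vertex (H.r h)))) h e = h := by
  rw [← hθ.eq_mulArr (hθ.one_mem_vertex (H.r h)) (H.s_one _), H.one_mul]

theorem mulArr_mul (hθ : IsPreActorFamily R θ) (z : G.Arr ⊕ X.carrier) (h k : H.Arr)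
    (e : X.src z = hθ.vertex (H.r h)) (e' : H.s h = H.r k) :
    H.mul (hθ.mulArr z h e) k ((hθ.s_mulArr z h e).trans e') =
      hθ.mulArr z (H.mul h k e') (e.trans (congrArg _ (H.r_mul h k e').symm)) := by
  refine (H.mul_assoc _ h k (hθ.s_lift _ _ _) e').trans ?_
  exact hθ.eq_mulArr (hθ.lift_mem _ _ _) _ _

/-- Equal products have equal ranges, so `(θ x)* θ x'` is nonempty and condition 2 puts `x` and `x'`
in one orbit. The factor from `θ x` is determined by its range and can be cancelled. -/
theorem mulArr_inr_eq_iff (hθ : IsPreActorFamily R θ) (x : X.carrier) (h : H.Arr)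
    (x' : X.carrier) (h' : H.Arr)
    (e : X.src (.inr x) = hθ.vertex (H.r h)) (e' : X.src (.inr x') = hθ.vertex (H.r h')) :
    hθ.mulArr (.inr x) h e = hθ.mulArr (.inr x') h' e' ↔
      ∃ (g : G.Arr) (e₁ : X.s x = G.r g) (e₂ : G.s g = hθ.vertex (H.r h')),
        x' = X.rmul x g e₁ ∧ h = hθ.mulArr (.inl g) h' e₂ := by
  constructor
  · intro heq
    have hr : H.r (hθ.lift (.inr x) _ e) = H.r (hθ.lift (.inr x') _ e') := by
      rw [← H.r_mul _ h (hθ.s_lift _ _ _), ← H.r_mul _ h' (hθ.s_lift _ _ _)]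
      exact congrArg H.r heq
    obtain ⟨g, e₁, rfl⟩ : X.SameOrbit x x' := by
      by_contra hne
      refine ((hθ.star_mul_empty x x' hne).subset ⟨_, ⟨_, hθ.lift_mem (.inr x) _ e, rfl⟩, _,
        hθ.lift_mem (.inr x') _ e', (H.s_inv _).trans hr, rfl⟩ : _ ∈ (∅ : Set H.Arr))
    have e₂ : G.s g = hθ.vertex (H.r h') := (X.right.anchor_act x g e₁).symm.trans e'
    refine ⟨g, e₁, e₂, rfl, ?_⟩
    have hv : X.src (.inr x) = hθ.vertex (H.r (hθ.mulArr (.inl g) h' e₂)) :=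
      Eq.trans e₁ (hθ.vertex_r_mulArr (.inl g) _ _).symm
    rw [← hθ.mulArr_mulArr (hθ.mul_corr_arr x g e₁) e₂ hv e'] at heq
    refine H.mul_left_cancel (a := hθ.lift (.inr x) _ e) (e := hθ.s_lift _ _ _) (e' := ?_)
      (heq.trans ?_)
    · refine (hθ.s_lift _ _ _).trans ?_
      have h₁ : hθ.lift (.inr x) _ e = hθ.lift (.inr x) _ hv := by
        refine (θ (.inr x)).2.2.1 (hθ.lift_mem _ _ _) (hθ.lift_mem _ _ _) ?_
        rw [← H.r_mul _ h (hθ.s_lift _ _ _), ← H.r_mul _ _ (hθ.s_lift (.inr x) _ hv)]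
        exact congrArg H.r heq
      rw [← hθ.s_lift (.inr x) _ e, ← hθ.s_lift (.inr x) _ hv, h₁]
    · exact (hθ.eq_mulArr (hθ.lift_mem _ _ _) _ _).symm
  · rintro ⟨g, e₁, e₂, rfl, rfl⟩
    exact hθ.mulArr_mulArr (hθ.mul_corr_arr x g e₁) e₂ _ _

theorem exists_mulArr_eq (hθ : IsPreActorFamily R θ) {x : X.carrier} {k : H.Arr} :
    (∃ h e, k = hθ.mulArr (.inr x) h e) ↔ H.r k ∈ H.r '' (θ (.inr x)).1 := by
  constructor
  · rintro ⟨h, e, rfl⟩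
    exact ⟨_, hθ.lift_mem _ _ _, (H.r_mul _ _ _).symm⟩
  · rintro ⟨t, ht, hr⟩
    exact ⟨_, hθ.mulArr_rel_iff.2 ⟨t, ht, _, (H.mul_inv_cancel_left t k hr).symm⟩⟩

theorem exists_mulArr_of_mem (hθ : IsPreActorFamily R θ) (k : H.Arr)
    (hk : hθ.vertex (H.r k) ∈ R) : ∃ x h e, k = hθ.mulArr (.inr x) h e := by
  have h₁ := hθ.cover_regular _ hk (hθ.one_mem_iff.1 (hθ.one_mem_vertex (H.r k)))
  obtain ⟨x, hx⟩ := mem_iUnion.1 h₁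
  exact ⟨x, hθ.exists_mulArr_eq.2 hx⟩

/-- Codomains depend only on the orbit, so the finitely many orbits in a compact set give finitely
many codomains. -/
theorem r_image_subset (hθ : IsPreActorFamily R θ) {x x' : X.carrier} (h : X.SameOrbit x x') :
    H.r '' (θ (.inr x')).1 ⊆ H.r '' (θ (.inr x)).1 := by
  obtain ⟨g, e, rfl⟩ := h
  rintro _ ⟨t, ht, rfl⟩
  rw [← hθ.mul_corr_arr x g e] at ht
  obtain ⟨a, ha, b, hb, e', rfl⟩ := ht
  exact ⟨a, ha, (H.r_mul _ _ _).symm⟩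

theorem isClosed_mulArr (hθ : IsPreActorFamily R θ) (hcl : HasClosedCodomains θ)
    (hG : DiscreteTopology G.Arr) (K : Set X.Orbits) (hK : IsCompact K) :
    IsClosed {k | ∃ x h e, Quotient.mk X.orbitSetoid x ∈ K ∧ k = hθ.mulArr (.inr x) h e} := by
  have h₁ : {k | ∃ x h e, Quotient.mk X.orbitSetoid x ∈ K ∧ k = hθ.mulArr (.inr x) h e} =
      ⋃ q ∈ K, H.r ⁻¹' (H.r '' (θ (.inr q.out)).1) := by
    ext k
    simp only [mem_ofPred_eq, mem_iUnion, exists_prop]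
    constructor
    · rintro ⟨x, h, e, hx, hk⟩
      exact ⟨_, hx, hθ.r_image_subset (Quotient.mk_out (s := X.orbitSetoid) x)
        (hθ.exists_mulArr_eq.1 ⟨h, e, hk⟩)⟩
    · rintro ⟨q, hq, hk⟩
      obtain ⟨h, e, hk'⟩ := hθ.exists_mulArr_eq.2 hk
      exact ⟨q.out, h, e, by rwa [Quotient.out_eq], hk'⟩
  rw [h₁]
  exact (GroupoidCorrespondence.finite_of_isCompact hG hK).isClosed_biUnion
    fun q _ => (hcl _).preimage H.continuous_r

theorem continuous_vertex (hθ : IsPreActorFamily R θ) (hG : DiscreteTopology G.Arr) :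
    Continuous hθ.vertex := by
  have := G.discreteTopology_obj hG
  rw [continuous_discrete_rng]
  intro v
  have h₁ : hθ.vertex ⁻¹' {v} = H.one ⁻¹' (θ (.inl (G.one v))).1 := by
    ext ω
    rw [mem_preimage, mem_preimage, hθ.one_mem_iff_eq_vertex, mem_singleton_iff, eq_comm]
  rw [h₁]
  exact (θ (.inl (G.one v))).2.1.preimage H.continuous_one

theorem continuous_mulArr (hθ : IsPreActorFamily R θ) (z : G.Arr ⊕ X.carrier) :
    Continuous fun h : {h : H.Arr // X.src z = hθ.vertex (H.r h)} => hθ.mulArr z h.1 h.2 := by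
  have h₁ : Continuous fun h : {h : H.Arr // X.src z = hθ.vertex (H.r h)} =>
      hθ.lift z (H.r h.1) h.2 := by
    refine (θ z).2.continuous_lift (fun h => hθ.lift_mem _ _ _) ?_
    simp_rw [hθ.s_lift]
    exact H.continuous_r.comp continuous_subtype_val
  exact H.continuous_mul.comp (f := fun h : {h : H.Arr // X.src z = hθ.vertex (H.r h)} =>
    (⟨(hθ.lift z (H.r h.1) h.2, h.1), hθ.s_lift z (H.r h.1) h.2⟩ :
      {p : H.Arr × H.Arr // H.s p.1 = H.r p.2}))
    (Continuous.subtype_mk (h₁.prodMk continuous_subtype_val) fun h => hθ.s_lift z (H.r h.1) h.2)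

theorem isOpenMap_mulArr (hθ : IsPreActorFamily R θ) (hG : DiscreteTopology G.Arr)
    (z : G.Arr ⊕ X.carrier) :
    IsOpenMap fun h : {h : H.Arr // X.src z = hθ.vertex (H.r h)} => hθ.mulArr z h.1 h.2 := by
  have := G.discreteTopology_obj hG
  have hU : IsOpen {h : H.Arr | X.src z = hθ.vertex (H.r h)} :=
    (isOpen_discrete {v | X.src z = v}).preimage
      ((hθ.continuous_vertex hG).comp H.continuous_r)
  refine (H.isLocalHomeomorph_of_s_comp (hθ.continuous_mulArr z) ?_).isOpenMap
  have h₁ : (H.s ∘ fun h : {h : H.Arr // X.src z = hθ.vertex (H.r h)} => hθ.mulArr z h.1 h.2) =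
      H.s ∘ Subtype.val := funext fun h => hθ.s_mulArr _ _ _
  rw [h₁]
  exact H.isLocalHomeomorph_s.comp hU.isOpenEmbedding_subtypeVal.isLocalHomeomorph

/-- The `(G, X, R)`-action on the arrow space of `H` by left multiplication with bisections. -/
noncomputable def corrAction (hθ : IsPreActorFamily R θ) (hcl : HasClosedCodomains θ)
    (hG : DiscreteTopology G.Arr) : CorrAction X R H.Arr where
  anchor h := hθ.vertex (H.r h)
  act g h e := hθ.mulArr (.inl g) h e
  continuous_anchor := (hθ.continuous_vertex hG).comp H.continuous_r
  continuous_act := continuous_of_discrete_fst (Q := fun g h => G.s g = hθ.vertex (H.r h))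
    fun g => hθ.continuous_mulArr (.inl g)
  anchor_act _ _ _ := hθ.vertex_r_mulArr _ _ _
  one_act h := hθ.mulArr_one h _
  mul_act g g' _ e _ := (hθ.mulArr_mulArr (hθ.mul_arr_arr g g' e) _ _ _).symm
  xact x h e := hθ.mulArr (.inr x) h e
  continuous_xact :=
    have := X.discreteTopology hG
    continuous_of_discrete_fst (Q := fun x h => X.s x = hθ.vertex (H.r h))
      fun x => hθ.continuous_mulArr (.inr x)
  isOpenMap_xact := isOpenMap_of_discrete_fst (Q := fun x h => X.s x = hθ.vertex (H.r h))
    fun x => hθ.isOpenMap_mulArr hG (.inr x)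
  anchor_xact _ _ _ := hθ.vertex_r_mulArr _ _ _
  act_xact g x _ e _ := hθ.mulArr_mulArr (hθ.mul_arr_corr g x e) _ _ _
  xact_eq_iff := hθ.mulArr_inr_eq_iff
  exists_xact_of_mem := hθ.exists_mulArr_of_mem
  isClosed_xact := hθ.isClosed_mulArr hcl hG

theorem commutesRight_corrAction (hθ : IsPreActorFamily R θ) (hcl : HasClosedCodomains θ)
    (hG : DiscreteTopology G.Arr) : (hθ.corrAction hcl hG).CommutesRight where
  anchor_mul h k e := congrArg hθ.vertex (H.r_mul h k e)
  s_act _ _ _ := hθ.s_mulArr _ _ _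
  act_mul g h k e e' := hθ.mulArr_mul (.inl g) h k e e'
  s_xact _ _ _ := hθ.s_mulArr _ _ _
  xact_mul x h k e e' := hθ.mulArr_mul (.inr x) h k e e'

theorem actsByFamily_corrAction (hθ : IsPreActorFamily R θ) (hcl : HasClosedCodomains θ)
    (hG : DiscreteTopology G.Arr) : ActsByFamily (hθ.corrAction hcl hG) θ :=
  ⟨fun g _ _ => hθ.mulArr_rel_iff (z := .inl g), fun x _ _ => hθ.mulArr_rel_iff (z := .inr x)⟩

/-- If the bisections of units are compact, then the codomains of all `θ x` are closed. -/
theorem hasClosedCodomains (hθ : IsPreActorFamily R θ) (hcomp : HasCompactUnits θ) :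
    HasClosedCodomains θ := by
  intro x
  have h₁ : IsCompact (H.s '' (θ (.inl (G.one (X.s x)))).1) :=
    (hcomp _).2.image H.continuous_s
  have h₂ : H.s '' (θ (.inl (G.one (X.s x)))).1 = range fun t : (θ (.inr x)).1 => H.s t := by
    ext ω
    rw [← hθ.one_mem_iff, hθ.one_mem_iff_eq_vertex]
    constructor
    · intro h
      obtain ⟨t, ht, hs⟩ := hθ.exists_mem_of_vertex (z := .inr x) h
      exact ⟨⟨t, ht⟩, hs⟩
    · rintro ⟨t, rfl⟩
      exact hθ.vertex_s t.2
  -- The source map identifies `θ x` with the compact domain of the unit `s(x)`. So `θ x` is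
  -- compact, and its image under `r` is compact in a Hausdorff space.
  rw [h₂, ← image_univ, ← (θ (.inr x)).2.isOpenEmbedding.isInducing.isCompact_iff] at h₁
  have h₃ := h₁.image (H.continuous_r.comp continuous_subtype_val)
  rw [image_comp, image_univ, Subtype.range_coe] at h₃
  exact h₃.isClosed

end IsPreActorFamily

/-! ### The (G,X,R)-action on fibrewise ultrafilters. -/

theorem continuous_ultrafilter_map {α β : Type*} (f : α → β) :
    Continuous (Ultrafilter.map f) :=
  continuous_generateFrom_iff.2 <| by
    rintro _ ⟨s, rfl⟩
    exact ultrafilter_isOpen_basic (f ⁻¹' s)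

theorem Ultrafilter.map_congr {α β : Type*} {f g : α → β} {U : Ultrafilter α}
    (h : ∀ᶠ a in (U : Filter α), f a = g a) : U.map f = U.map g :=
  Ultrafilter.coe_injective (Filter.map_congr h)

theorem GroupoidCorrespondence.IsRegularOn.finite_rStar_preimage (hX : X.IsRegularOn R)
    (hG : DiscreteTopology G.Arr) {v : G.Obj} (hv : v ∈ R) : (X.rStar ⁻¹' {v}).Finite := by
  have h₁ : IsCompact (R.restrictPreimage X.rStar ⁻¹' {⟨v, hv⟩}) :=
    hX.1.isCompact_preimage isCompact_singleton
  refine finite_of_isCompact hG ?_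
  convert h₁.image continuous_subtype_val
  ext q
  constructor
  · intro hq
    have hq' : X.rStar q = v := hq
    exact ⟨⟨q, by rwa [mem_preimage, hq']⟩, Subtype.ext hq', rfl⟩
  · rintro ⟨q, hq, rfl⟩
    exact congrArg Subtype.val hq

namespace CorrAction

variable {Y : Type u} [TopologicalSpace Y] (c : CorrAction X R Y)

/-- The set of products `z · h` for fixed `z`. -/
def relRange (z : G.Arr ⊕ X.carrier) : Set Y := {k | ∃ h, c.Rel z h k}

variable {c}

theorem relRange_subset {x x' : X.carrier} (h : X.SameOrbit x x') :
    c.relRange (.inr x') ⊆ c.relRange (.inr x) := by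
  obtain ⟨g, e, rfl⟩ := h
  rintro k ⟨h, hk⟩
  obtain ⟨b, -, hb⟩ := (rel_rmul x g e).2 hk
  exact ⟨b, hb⟩

variable (c)

open Classical in
/-- The partial map `h ↦ z · h`, extended by the identity. -/
noncomputable def relMap (z : G.Arr ⊕ X.carrier) (h : Y) : Y :=
  if H : ∃ k, c.Rel z h k then H.choose else h

open Classical in
/-- The partial map `z · h ↦ h`, extended by the identity. -/
noncomputable def relInv (z : G.Arr ⊕ X.carrier) (k : Y) : Y :=
  if H : ∃ h, c.Rel z h k then H.choose else k

variable {c} {z w y : G.Arr ⊕ X.carrier}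

theorem rel_relMap {h : Y} (e : X.src z = c.anchor h) : c.Rel z h (c.relMap z h) := by
  have H := exists_rel (c := c) e
  rw [relMap, dif_pos H]
  exact H.choose_spec

theorem relInv_rel {k : Y} (H : k ∈ c.relRange z) : c.Rel z (c.relInv z k) k := by
  rw [relInv, dif_pos (show ∃ h, c.Rel z h k from H)]
  exact H.choose_spec

variable (c) in
/-- The space of ultrafilters on `Y` that live on one fibre of the anchor map. -/
abbrev UltraSpace : Type u :=
  {U : Ultrafilter Y // ∃ v, ∀ᶠ y in (U : Filter Y), c.anchor y = v}

namespace UltraSpace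

/-- The anchor map on ultrafilters. -/
noncomputable def vertex (U : c.UltraSpace) : G.Obj := U.2.choose

theorem eventually_anchor (U : c.UltraSpace) :
    ∀ᶠ y in (U.1 : Filter Y), c.anchor y = U.vertex := U.2.choose_spec

theorem vertex_eq {U : c.UltraSpace} {v : G.Obj}
    (h : ∀ᶠ y in (U.1 : Filter Y), c.anchor y = v) : U.vertex = v := by
  obtain ⟨y, h₁, h₂⟩ := (U.eventually_anchor.and h).exists
  exact h₁.symm.trans h₂

theorem vertex_preimage (v : G.Obj) : vertex ⁻¹' {v} =
    (Subtype.val ⁻¹' {U : Ultrafilter Y | c.anchor ⁻¹' {v} ∈ U} : Set c.UltraSpace) := by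
  ext U
  constructor
  · rintro rfl
    exact U.eventually_anchor
  · exact vertex_eq

theorem continuous_vertex (hG : DiscreteTopology G.Arr) :
    Continuous (vertex : c.UltraSpace → G.Obj) := by
  have := G.discreteTopology_obj hG
  rw [continuous_discrete_rng]
  intro v
  rw [vertex_preimage]
  exact (ultrafilter_isOpen_basic _).preimage continuous_subtype_val

/-- The fibre is a basic clopen subset of the compact space of all ultrafilters. -/
theorem isCompact_vertex_preimage (v : G.Obj) :
    IsCompact (vertex ⁻¹' {v} : Set c.UltraSpace) := by
  rw [vertex_preimage, Subtype.isCompact_iff, image_preimage_eq_of_subset]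
  · exact (ultrafilter_isClosed_basic _).isCompact
  · intro U hU
    exact ⟨⟨U, v, hU⟩, rfl⟩

theorem eventually_rel (U : c.UltraSpace) (e : X.src z = U.vertex) :
    ∀ᶠ y in (U.1 : Filter Y), c.Rel z y (c.relMap z y) :=
  U.eventually_anchor.mono fun _ h => rel_relMap (e.trans h.symm)

theorem eventually_anchor_relMap (U : c.UltraSpace) (e : X.src z = U.vertex) :
    ∀ᶠ y in (U.1.map (c.relMap z) : Filter Y), c.anchor y = X.tgt z :=
  (U.eventually_rel e).mono fun _ h => h.anchor_eq

/-- The product of `z ∈ G ⊔ X` with an ultrafilter. -/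
noncomputable def mul (z : G.Arr ⊕ X.carrier) (U : c.UltraSpace) (e : X.src z = U.vertex) :
    c.UltraSpace :=
  ⟨U.1.map (c.relMap z), X.tgt z, U.eventually_anchor_relMap e⟩

theorem vertex_mul (U : c.UltraSpace) (e : X.src z = U.vertex) :
    (U.mul z e).vertex = X.tgt z :=
  vertex_eq (U.eventually_anchor_relMap e)

theorem mul_one (U : c.UltraSpace) (e : X.src (.inl (G.one U.vertex)) = U.vertex) :
    U.mul (.inl (G.one U.vertex)) e = U := by
  refine Subtype.ext (Eq.trans (Ultrafilter.map_congr ?_) (Ultrafilter.map_id _))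
  exact (U.eventually_rel e).mono fun y h => (rel_inl_one.1 h).2

theorem mul_mul (hy : ∀ h k, (∃ b, c.Rel w h b ∧ c.Rel z b k) ↔ c.Rel y h k)
    (U : c.UltraSpace) (e : X.src w = U.vertex) (e' : X.src z = (U.mul w e).vertex)
    (e'' : X.src y = U.vertex) : (U.mul w e).mul z e' = U.mul y e'' := by
  refine Subtype.ext ?_
  change Ultrafilter.map _ (Ultrafilter.map _ _) = _
  rw [Ultrafilter.map_map]
  refine Ultrafilter.map_congr ?_
  have h₁ := (U.mul w e).eventually_rel e'
  filter_upwards [U.eventually_rel e, h₁, U.eventually_rel e''] with h h₁ h₂ h₃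
  exact ((hy _ _).1 ⟨_, h₁, h₂⟩).right_unique h₃

theorem map_relInv_mul (U : c.UltraSpace) (e : X.src z = U.vertex) :
    (U.mul z e).1.map (c.relInv z) = U.1 := by
  change Ultrafilter.map _ (Ultrafilter.map _ _) = _
  rw [Ultrafilter.map_map]
  refine Eq.trans (Ultrafilter.map_congr ?_) (Ultrafilter.map_id _)
  filter_upwards [U.eventually_rel e] with h hh
  exact (relInv_rel ⟨_, hh⟩).left_unique hh

theorem mul_injective {U V : c.UltraSpace} {e : X.src z = U.vertex} {e' : X.src z = V.vertex}
    (h : U.mul z e = V.mul z e') : U = V := by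
  refine Subtype.ext ?_
  rw [← U.map_relInv_mul e, ← V.map_relInv_mul e', h]

/-- An ultrafilter that contains the range of `z` can be pulled back along the injective partial map
`h ↦ z · h`. -/
theorem exists_mul_eq {V : c.UltraSpace} :
    (∃ (U : c.UltraSpace) (e : X.src z = U.vertex), V = U.mul z e) ↔ c.relRange z ∈ V.1 := by
  constructor
  · rintro ⟨U, e, rfl⟩
    exact (U.eventually_rel e).mono fun y h => ⟨y, h⟩
  · intro hV
    have h₁ : ∀ᶠ k in (V.1 : Filter Y), c.Rel z (c.relInv z k) k :=
      Eventually.mono hV fun _ => relInv_rel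
    have h₂ : ∀ᶠ y in (V.1.map (c.relInv z) : Filter Y), c.anchor y = X.src z :=
      h₁.mono fun _ h => h.src_eq.symm
    refine ⟨⟨V.1.map (c.relInv z), _, h₂⟩, (vertex_eq h₂).symm, Subtype.ext ?_⟩
    change _ = Ultrafilter.map _ (Ultrafilter.map _ _)
    rw [Ultrafilter.map_map]
    refine ((Ultrafilter.map_congr ?_).trans (Ultrafilter.map_id _)).symm
    filter_upwards [h₁] with k hk
    exact (rel_relMap hk.src_eq).right_unique hk

theorem continuous_mul (z : G.Arr ⊕ X.carrier) :
    Continuous fun U : {U : c.UltraSpace // X.src z = U.vertex} => U.1.mul z U.2 :=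
  Continuous.subtype_mk ((continuous_ultrafilter_map _).comp
    (continuous_subtype_val.comp continuous_subtype_val)) _

theorem isOpenMap_mul (z : G.Arr ⊕ X.carrier) :
    IsOpenMap fun U : {U : c.UltraSpace // X.src z = U.vertex} => U.1.mul z U.2 := by
  have : CompactSpace {U : c.UltraSpace // X.src z = U.vertex} := by
    have h₀ : IsCompact {U : c.UltraSpace | X.src z = U.vertex} := ?_
    · exact isCompact_iff_compactSpace.1 h₀
    convert isCompact_vertex_preimage (c := c) (X.src z) using 1
    ext U
    exact eq_comm
  -- An injective continuous map from a compact to a Hausdorff space is an embedding; its range is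
  -- basic open.
  have h₁ := (continuous_mul (c := c) z).isClosedEmbedding
    fun U V h => Subtype.ext (mul_injective h)
  refine Topology.IsOpenEmbedding.isOpenMap ⟨h₁.isEmbedding, ?_⟩
  have h₂ : range (fun U : {U : c.UltraSpace // X.src z = U.vertex} => U.1.mul z U.2) =
      Subtype.val ⁻¹' {V : Ultrafilter Y | c.relRange z ∈ V} := by
    ext V
    refine Iff.trans ?_ exists_mul_eq
    constructor
    · rintro ⟨U, rfl⟩
      exact ⟨U.1, U.2, rfl⟩
    · rintro ⟨U, e, rfl⟩
      exact ⟨⟨U, e⟩, rfl⟩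
  rw [h₂]
  exact (ultrafilter_isOpen_basic _).preimage continuous_subtype_val

theorem mul_inr_eq_iff (x : X.carrier) (U : c.UltraSpace) (x' : X.carrier) (V : c.UltraSpace)
    (e : X.src (.inr x) = U.vertex) (e' : X.src (.inr x') = V.vertex) :
    U.mul (.inr x) e = V.mul (.inr x') e' ↔
      ∃ (g : G.Arr) (e₁ : X.s x = G.r g) (e₂ : G.s g = V.vertex),
        x' = X.rmul x g e₁ ∧ U = V.mul (.inl g) e₂ := by
  constructor
  · intro heq
    have h₁ := exists_mul_eq.1 ⟨V, e', heq⟩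
    have h₂ := exists_mul_eq.1 ⟨U, e, rfl⟩
    -- Both ranges belong to one ultrafilter, so they meet in a point, which already forces a common
    -- orbit.
    obtain ⟨k, ⟨a, ha⟩, b, hb⟩ := Ultrafilter.nonempty_of_mem (inter_mem h₂ h₁)
    obtain ⟨g, e₁, rfl⟩ := sameOrbit_of_rel ha hb
    have e₂ : G.s g = V.vertex := (X.right.anchor_act x g e₁).symm.trans e'
    have e₃ : X.src (.inr x) = (V.mul (.inl g) e₂).vertex :=
      Eq.trans e₁ (V.vertex_mul (z := .inl g) e₂).symm
    refine ⟨g, e₁, e₂, rfl, mul_injective (e := e) (e' := e₃) ?_⟩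
    exact heq.trans (V.mul_mul (fun _ _ => rel_rmul x g e₁) e₂ _ e').symm
  · rintro ⟨g, e₁, e₂, rfl, rfl⟩
    exact V.mul_mul (fun _ _ => rel_rmul x g e₁) e₂ _ _

/-- Regularity enters here: only finitely many orbits lie over a vertex in `R`. Their ranges cover
the fibre, and an ultrafilter picks one member of a finite cover. -/
theorem exists_mul_of_mem (hG : DiscreteTopology G.Arr) (hX : X.IsRegularOn R)
    (V : c.UltraSpace) (hV : V.vertex ∈ R) :
    ∃ (x : X.carrier) (U : c.UltraSpace) (e : X.src (.inr x) = U.vertex),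
      V = U.mul (.inr x) e := by
  have h₁ : (⋃ q ∈ X.rStar ⁻¹' {V.vertex}, c.relRange (.inr q.out)) ∈ V.1 := by
    change ∀ᶠ y in (V.1 : Filter Y), y ∈ ⋃ q ∈ X.rStar ⁻¹' {V.vertex}, c.relRange (.inr q.out)
    refine V.eventually_anchor.mono fun y hy => ?_
    obtain ⟨x, y', e, h⟩ := c.exists_xact_of_mem y (hy ▸ hV)
    refine mem_iUnion₂.2 ⟨Quotient.mk _ x, ?_,
      relRange_subset (Quotient.mk_out (s := X.orbitSetoid) x) ⟨y', e, h⟩⟩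
    rw [mem_preimage, mem_singleton_iff, ← hy, h, c.anchor_xact]
    rfl
  obtain ⟨q, -, hq⟩ :=
    (Ultrafilter.finite_biUnion_mem_iff (hX.finite_rStar_preimage hG hV)).1 h₁
  exact ⟨q.out, exists_mul_eq.2 hq⟩

theorem isClosed_mul (hG : DiscreteTopology G.Arr) (K : Set X.Orbits) (hK : IsCompact K) :
    IsClosed {V : c.UltraSpace | ∃ (x : X.carrier) (U : c.UltraSpace)
      (e : X.src (.inr x) = U.vertex), Quotient.mk X.orbitSetoid x ∈ K ∧ V = U.mul (.inr x) e} := by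
  have h₁ : {V : c.UltraSpace | ∃ (x : X.carrier) (U : c.UltraSpace)
      (e : X.src (.inr x) = U.vertex), Quotient.mk X.orbitSetoid x ∈ K ∧ V = U.mul (.inr x) e} =
      ⋃ q ∈ K, Subtype.val ⁻¹' {V : Ultrafilter Y | c.relRange (.inr q.out) ∈ V} := by
    ext V
    simp only [mem_ofPred_eq, mem_iUnion, exists_prop, mem_preimage]
    constructor
    · rintro ⟨x, U, e, hx, hV⟩
      exact ⟨_, hx, mem_of_superset (exists_mul_eq.1 ⟨U, e, hV⟩)
        (relRange_subset (Quotient.mk_out (s := X.orbitSetoid) x))⟩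
    · rintro ⟨q, hq, hV⟩
      obtain ⟨U, e, hU⟩ := exists_mul_eq.2 hV
      exact ⟨q.out, U, e, by rwa [Quotient.out_eq], hU⟩
  rw [h₁]
  exact (GroupoidCorrespondence.finite_of_isCompact hG hK).isClosed_biUnion
    fun q _ => (ultrafilter_isClosed_basic _).preimage continuous_subtype_val

end UltraSpace

variable (c)

/-- The `(G, X, R)`-action on the space of ultrafilters. -/
noncomputable def ultra (hG : DiscreteTopology G.Arr) (hX : X.IsRegularOn R) :
    CorrAction X R c.UltraSpace where
  anchor U := U.vertex
  act g U e := U.mul (.inl g) e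
  continuous_anchor := UltraSpace.continuous_vertex hG
  continuous_act := continuous_of_discrete_fst
    (Q := fun (g : G.Arr) (U : c.UltraSpace) => G.s g = U.vertex)
    fun g => UltraSpace.continuous_mul (.inl g)
  anchor_act g U e := U.vertex_mul (z := .inl g) e
  one_act U := U.mul_one _
  mul_act g g' U e _ := (U.mul_mul (fun _ _ => rel_mul g g' e) _ _ _).symm
  xact x U e := U.mul (.inr x) e
  continuous_xact :=
    have := X.discreteTopology hG
    continuous_of_discrete_fst
      (Q := fun (x : X.carrier) (U : c.UltraSpace) => X.s x = U.vertex)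
      fun x => UltraSpace.continuous_mul (.inr x)
  isOpenMap_xact := isOpenMap_of_discrete_fst
    (Q := fun (x : X.carrier) (U : c.UltraSpace) => X.s x = U.vertex)
    fun x => UltraSpace.isOpenMap_mul (.inr x)
  anchor_xact x U e := U.vertex_mul (z := .inr x) e
  act_xact g x U e _ := U.mul_mul (fun _ _ => rel_lmul g x e) _ _ _
  xact_eq_iff := UltraSpace.mul_inr_eq_iff
  exists_xact_of_mem := UltraSpace.exists_mul_of_mem hG hX
  isClosed_xact := UltraSpace.isClosed_mul hG

end CorrAction

/-! ### Compactness of the fibres of the universal anchor map. -/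

/-- A copy of a type with the discrete topology. -/
def Discretization (Y : Type u) : Type u := Y

instance (Y : Type u) : TopologicalSpace (Discretization Y) := ⊥

instance (Y : Type u) : DiscreteTopology (Discretization Y) := ⟨rfl⟩

namespace CorrAction

variable {Y : Type u} [TopologicalSpace Y] (c : CorrAction X R Y)

/-- The `(G, X, R)`-action on the underlying set with the discrete topology. -/
def discretize (hG : DiscreteTopology G.Arr) : CorrAction X R (Discretization Y) where
  anchor := c.anchor
  act := c.act
  continuous_anchor := continuous_of_discreteTopology
  continuous_act := continuous_of_discreteTopology
  anchor_act := c.anchor_act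
  one_act := c.one_act
  mul_act := c.mul_act
  xact := c.xact
  continuous_xact :=
    have := X.discreteTopology hG
    continuous_of_discreteTopology
  isOpenMap_xact _ _ := isOpen_discrete _
  anchor_xact := c.anchor_xact
  act_xact := c.act_xact
  xact_eq_iff := c.xact_eq_iff
  exists_xact_of_mem := c.exists_xact_of_mem
  isClosed_xact _ _ := isClosed_discrete _

theorem isEquivariant_discretize (hG : DiscreteTopology G.Arr) :
    (c.discretize hG).IsEquivariant c (id : Y → Y) :=
  ⟨⟨fun _ => rfl, fun _ _ _ => rfl, fun _ _ _ => rfl⟩, rfl⟩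

theorem IsEquivariant.comp {Y₁ Y₂ Y₃ : Type u} [TopologicalSpace Y₁] [TopologicalSpace Y₂]
    [TopologicalSpace Y₃] {c₁ : CorrAction X R Y₁} {c₂ : CorrAction X R Y₂}
    {c₃ : CorrAction X R Y₃} {ψ : Y₂ → Y₃} {φ : Y₁ → Y₂} (hψ : c₂.IsEquivariant c₃ ψ)
    (hφ : c₁.IsEquivariant c₂ φ) : c₁.IsEquivariant c₃ (ψ ∘ φ) := by
  obtain ⟨⟨a₁, b₁, d₁⟩, i₁⟩ := hψ
  obtain ⟨⟨a₂, b₂, d₂⟩, i₂⟩ := hφ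
  refine ⟨⟨fun y => (a₁ _).trans (a₂ y), fun g y e => ?_, fun x y e => ?_⟩, ?_⟩
  · exact (congrArg ψ (b₂ g y e)).trans (b₁ _ _ _)
  · exact (congrArg ψ (d₂ x y e)).trans (d₁ _ _ _)
  · rw [preimage_comp, i₁, i₂]

/-- The principal ultrafilter, as an element of `UltraSpace`. -/
def UltraSpace.principal (y : Discretization Y) : c.UltraSpace :=
  ⟨(pure y : Ultrafilter Y), c.anchor y, rfl⟩

/-- The domain is discretized because `y ↦ pure y` need not be continuous for the original topology,
while the model only handles continuous maps. -/
theorem isEquivariant_principal (hG : DiscreteTopology G.Arr) (hX : X.IsRegularOn R) :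
    (c.discretize hG).IsEquivariant (c.ultra hG hX) (UltraSpace.principal c) := by
  have h₀ (y : Y) : (UltraSpace.principal c y).vertex = c.anchor y :=
    UltraSpace.vertex_eq (U := UltraSpace.principal c y) rfl
  have h₁ (z : G.Arr ⊕ X.carrier) (y k : Y) (e) (h : c.Rel z y k) :
      UltraSpace.principal c k = (UltraSpace.principal c y).mul z e :=
    Subtype.ext (congrArg pure (h.right_unique (rel_relMap h.src_eq)))
  refine ⟨⟨h₀, fun g y e => h₁ (.inl g) _ _ (e.trans (h₀ y).symm) ⟨e, rfl⟩,
    fun x y e => h₁ (.inr x) _ _ (e.trans (h₀ y).symm) ⟨e, rfl⟩⟩, ?_⟩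
  ext y
  exact exists_congr fun x =>
    UltraSpace.exists_mul_eq (z := .inr x) (V := UltraSpace.principal c y)

end CorrAction

/-- The anchor map of the universal action has compact fibres. -/
theorem GroupoidModel.isCompact_univ_anchor_preimage (𝓜 : GroupoidModel X R)
    (hG : DiscreteTopology G.Arr) (hX : X.IsRegularOn R) (v : G.Obj) :
    IsCompact (𝓜.univ.anchor ⁻¹' {v}) := by
  set d := 𝓜.univ.discretize hG
  set p := (𝓜.actionEquiv _ (𝓜.univ.ultra hG hX)).anchor with hp
  have hpc : Continuous p := LeftAction.continuous_anchor _
  have hpe := 𝓜.isEquivariant_anchor (𝓜.univ.ultra hG hX)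
  rw [← hp] at hpe
  -- Both sides are continuous equivariant maps from the discretized space to `M⁰`, so they agree.
  have h₁ : p ∘ CorrAction.UltraSpace.principal 𝓜.univ = id :=
    (𝓜.eq_anchor_of_isEquivariant d continuous_of_discreteTopology
      (hpe.comp (𝓜.univ.isEquivariant_principal hG hX))).trans
      (𝓜.eq_anchor_of_isEquivariant d continuous_of_discreteTopology
        (𝓜.univ.isEquivariant_discretize hG)).symm
  obtain ⟨⟨hanc, -, -⟩, -⟩ := hpe
  convert (CorrAction.UltraSpace.isCompact_vertex_preimage (c := 𝓜.univ) v).image hpc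
  ext ω
  constructor
  · rintro rfl
    exact ⟨_, CorrAction.UltraSpace.vertex_eq (U := .principal 𝓜.univ ω) rfl, congrFun h₁ ω⟩
  · rintro ⟨U, rfl, rfl⟩
    exact hanc U

/-! ### The bijection with actors, and properness. -/

variable {H : EtaleGroupoid.{u}}

/-- The anchor map can be read off from which units act; the two multiplications are then given by
the relation. -/
theorem CorrAction.eq_of_rel {Y : Type u} [TopologicalSpace Y] {c c' : CorrAction X R Y}
    (h : ∀ z h k, c.Rel z h k ↔ c'.Rel z h k) : c = c' := by
  have h₀ : c.anchor = c'.anchor := by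
    funext y
    exact (rel_inl_one.1 ((h _ _ _).1 (rel_inl_one.2 ⟨rfl, rfl⟩ :
      c.Rel (.inl (G.one (c.anchor y))) y y))).1
  have h₁ (g : G.Arr) (y : Y) (e e') : c.act g y e = c'.act g y e' := by
    obtain ⟨_, h'⟩ := (h (.inl g) y _).1 ⟨e, rfl⟩
    exact h'
  have h₂ (x : X.carrier) (y : Y) (e e') : c.xact x y e = c'.xact x y e' := by
    obtain ⟨_, h'⟩ := (h (.inr x) y _).1 ⟨e, rfl⟩
    exact h'
  clear h
  rcases c with ⟨⟨anchor, act⟩, xact⟩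
  rcases c' with ⟨⟨anchor', act'⟩, xact'⟩
  obtain rfl : anchor = anchor' := h₀
  obtain rfl : act = act' := by
    funext g y e
    exact h₁ g y e e
  obtain rfl : xact = xact' := by
    funext x y e
    exact h₂ x y e e
  rfl

theorem Actor.commutesRight {M : EtaleGroupoid.{u}} (a : Actor M H) :
    a.toLeftAction.CommutesRight :=
  ⟨a.anchor_mul, a.s_act, a.act_mul⟩

namespace GroupoidModel

variable (𝓜 : GroupoidModel X R)

theorem commutesRight_actor (a : Actor 𝓜.M H) :
    ((𝓜.actionEquiv H.Arr).symm a.toLeftAction).CommutesRight := by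
  rw [← 𝓜.commutesRight_iff, Equiv.apply_symm_apply]
  exact a.commutesRight

/-- The bijection between actors and families of bisections. -/
noncomputable def actorEquiv (hG : DiscreteTopology G.Arr) : Actor 𝓜.M H ≃
    {θ : G.Arr ⊕ X.carrier → H.Bisection // IsPreActorFamily R θ ∧ HasClosedCodomains θ} where
  toFun a := ⟨(𝓜.commutesRight_actor a).family hG,
    (𝓜.commutesRight_actor a).isPreActorFamily hG,
    (𝓜.commutesRight_actor a).hasClosedCodomains hG⟩
  invFun θ :=
    have hc := (𝓜.commutesRight_iff _).2 (θ.2.1.commutesRight_corrAction θ.2.2 hG)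
    { toLeftAction := 𝓜.actionEquiv H.Arr (θ.2.1.corrAction θ.2.2 hG)
      anchor_mul := hc.anchor_mul
      s_act := hc.s_act
      act_mul := hc.act_mul }
  left_inv a := by
    have hc := 𝓜.commutesRight_actor a
    have h₁ : (hc.isPreActorFamily hG).corrAction (hc.hasClosedCodomains hG) hG =
        (𝓜.actionEquiv H.Arr).symm a.toLeftAction :=
      CorrAction.eq_of_rel fun z h k =>
        (CorrAction.actsByFamily_iff.1
          ((hc.isPreActorFamily hG).actsByFamily_corrAction _ hG) z h k).trans
        (CorrAction.actsByFamily_iff.1 (hc.actsByFamily hG) z h k).symm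
    have h₂ := (𝓜.actionEquiv H.Arr).symm_apply_eq.1 h₁.symm
    rcases a with ⟨a⟩
    dsimp only at h₂ ⊢
    congr 1
    exact h₂.symm
  right_inv θ := by
    refine Subtype.ext (funext fun z => Subtype.ext (Set.ext fun t => ?_))
    refine Iff.trans ?_ (CorrAction.mem_of_actsByFamily
      (θ.2.1.actsByFamily_corrAction θ.2.2 hG) z t).symm
    change CorrAction.Rel ((𝓜.actionEquiv H.Arr).symm (𝓜.actionEquiv H.Arr _)) _ _ _ ↔ _
    rw [Equiv.symm_apply_apply]

theorem univ_anchor_objMap (a : Actor 𝓜.M H) (ω : H.Obj) :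
    𝓜.univ.anchor (a.objMap ω) =
      ((𝓜.actionEquiv H.Arr).symm a.toLeftAction).anchor (H.one ω) := by
  obtain ⟨⟨h, -⟩, -⟩ := 𝓜.isEquivariant_anchor ((𝓜.actionEquiv H.Arr).symm a.toLeftAction)
  have h₁ := h (H.one ω)
  rwa [Equiv.apply_symm_apply] at h₁

theorem isProper_iff (hG : DiscreteTopology G.Arr) (hX : X.IsRegularOn R) (a : Actor 𝓜.M H) :
    a.IsProper ↔ HasCompactUnits (𝓜.actorEquiv hG a).1 := by
  have hc := 𝓜.commutesRight_actor a
  have hpre (v : G.Obj) : {ω | v = ((𝓜.actionEquiv H.Arr).symm a.toLeftAction).anchor (H.one ω)} =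
      (𝓜.univ.anchor ∘ a.objMap) ⁻¹' {v} := by
    ext ω
    rw [mem_preimage, Function.comp_apply, univ_anchor_objMap, mem_singleton_iff, mem_ofPred_eq,
      eq_comm]
  have hfam (v : G.Obj) : ((𝓜.actorEquiv hG a).1 (.inl (G.one v))).1 =
      H.one '' ((𝓜.univ.anchor ∘ a.objMap) ⁻¹' {v}) := by
    rw [← hpre]
    exact CorrAction.CommutesRight.famSet_inl_one v
  have hcont : Continuous a.objMap := a.continuous_anchor.comp H.continuous_one
  constructor
  · intro ha v
    rw [hfam]
    refine ⟨image_subset_range _ _, IsCompact.image ?_ H.continuous_one⟩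
    -- The units in `θ v` are the preimage under the proper map `H⁰ → M⁰` of a compact fibre.
    exact IsProperMap.isCompact_preimage ha (𝓜.isCompact_univ_anchor_preimage hG hX v)
  · intro ha
    have := G.discreteTopology_obj hG
    -- As `M⁰` is Hausdorff, it suffices that the composite `H⁰ → G⁰` is proper. Compact subsets of
    -- the discrete space `G⁰` are finite, so compact fibres are enough.
    refine isProperMap_of_comp_of_t2 hcont 𝓜.univ.continuous_anchor
      (isProperMap_iff_isCompact_preimage.2 ⟨𝓜.univ.continuous_anchor.comp hcont, fun K hK => ?_⟩)
    rw [← biUnion_preimage_singleton]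
    refine (hK.finite_of_discrete).isCompact_biUnion fun v _ => ?_
    have h₁ := (ha v).2.image H.continuous_s
    rwa [hfam, image_image, funext (fun ω => H.s_one ω), image_id'] at h₁

end GroupoidModel

theorem mainTheorem4 (G H : EtaleGroupoid.{u}) (R : Set G.Obj) (hRopen : IsOpen R)
    (hRinv : G.IsInvariant R) (X : GroupoidCorrespondence G G) (hX : X.IsRegularOn R)
    (hG : DiscreteTopology G.Arr) (𝓜 : GroupoidModel X R) :
    (∃ Φ : Actor 𝓜.M H ≃
        {θ : G.Arr ⊕ X.carrier → H.Bisection // IsPreActorFamily R θ ∧ HasClosedCodomains θ},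
      (∀ a : Actor 𝓜.M H,
        ActsByFamily ((𝓜.actionEquiv H.Arr).symm a.toLeftAction) (Φ a).1) ∧
      (∀ a : Actor 𝓜.M H, a.IsProper ↔ HasCompactUnits (Φ a).1)) ∧
    (∀ θ : G.Arr ⊕ X.carrier → H.Bisection,
      IsPreActorFamily R θ → HasCompactUnits θ → HasClosedCodomains θ) :=
  ⟨⟨𝓜.actorEquiv hG, fun a => (𝓜.commutesRight_actor a).actsByFamily hG,
    𝓜.isProper_iff hG hX⟩, fun _ hθ => hθ.hasClosedCodomains⟩
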